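/- \textbf{Definitions.} Let $n\ge 0$, $[[n]]=\{1,\bar 1,\dots,n,\bar n\}$ with its involution $i\leftrightarrow\bar i$, and for $X\subseteq[[n]]$ let $\overline X=\{\bar x: x\in X\}$. Let $\Sigma$ be a finite set of signs with a distinguished element $\bar\sigma\in\Sigma$. A \emph{$\Sigma$-labeled partition} of $[[n]]$ is a partition $\pi$ of $[[n]]$ into nonempty blocks together with an injection $f:T\to\Sigma$ defined on a subset $T\subseteq\pi$ (the signed blocks), such that $R\in\pi$ implies $\overline R\in\pi$, and a block $S\in\pi$ satisfies $S=\overline S$ if and only if it is signed. Let $\Sigma(\pi)=f(T)$ and, for $\sigma\in\Sigma(\pi)$, let $\pi_\sigma$ be the block with sign $\sigma$; put $\pi_\sigma=\emptyset$ for $\sigma\notin\Sigma(\pi)$. Put $\pi\preceq\psi$ if every block of $\pi$ is contained in a block of $\psi$ and $\pi_\sigma\subseteq\psi_\sigma$ for all $\sigma\in\Sigma$. Let $\Pi_{n,\Sigma}$ be the poset of all $\Sigma$-labeled partitions of $[[n]]$ with a new greatest element $\hat 1$ added. Consider the following sets of $\Sigma$-labeled partitions $x$ of $[[n]]$: \begin{itemize}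 \item type $A_n$: $x=R_1|\overline{R_1}|\cdots|R_k|\overline{R_k}$ with $R_1|\cdots|R_k$ a partition of $[n]=\{1,\dots,n\}$; \item type $B_n$: $|x_\sigma|\ne 2$ for all $\sigma\neq\bar\sigma$; \item type $C_n$: all $x$; \item type $D_n$: $|x_\sigma|\neq2$ for all $\sigma\in\Sigma$. \end{itemize} An edge labeling of a poset $P$ with values in a poset $\Lambda$ is an \emph{EL-labeling} if every interval $[x,y]$ has a unique maximal chain whose word of labels is strictly increasing, and the word of this chain lexicographically strictly precedes the words of all other maximal chains of $[x,y]$. A bounded poset is \emph{EL-shellable} if it has an EL-labeling. Given a total order on $\Sigma$, define labels in $\mathbb N\times\mathbb N$, ordered lexicographically. The representative $r(R)$ of a block $R$ is the least $i\in[n]$ with $i\in R$ or $\bar i\in R$; the block $R$ is normalized if $r(R)\in R$. For $x\prec y$ with $y\neq\hat 1$ that form an edge of the Hasse diagram, let \begin{itemize} \item $\lambda(x,y)=(1,|\{\tau\in\Sigma(x):\tau\le\sigma\}|)$ if $x_\sigma\subsetneq y_\sigma$ with $\sigma\in\Sigma(x)$; \item $\lambda(x,y)=(1,|\{\tau\in\Sigma:\tau\le\sigma\}\cup\Sigma(x)|)$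 if $x_\sigma\subsetneq y_\sigma$ with $\sigma\notin\Sigma(x)$; \item otherwise $\lambda(x,y)=(0,\max(r(R),r(R')))$ if $R\cup R'$ is a block of $y$, and $\lambda(x,y)=(2,\min(r(R),r(R')))$ if $R\cup\overline{R'}$ is a block of $y$, for distinct normalized unsigned blocks $R,R'$ of $x$. \end{itemize} Edges that end in $\hat 1$ have label $(1,2)$. \textbf{Theorem.} Let $\Sigma$ be a finite set with a distinguished element $\bar\sigma$ and let $n\geq 0$. \begin{enumerate} \item For each of the types $A_n,B_n,C_n,D_n$, the poset of $\Sigma$-labeled partitions of this type, with $\hat 1$ added, is EL-shellable. \item The poset of $\Sigma$-labeled partitions of type $A_n$ without $\hat1$ is EL-shellable, and so is the poset of any of the types without $\hat 1$ whenever it has a greatest element. \item For every total order on $\Sigma$ and each type (for type $B_n$ with $n=1$, assume that $\bar\sigma$ is the least element of $\Sigma$), $\lambda$ is an EL-labeling of the poset of $\Sigma$-labeled partitions of this type, both with and without $\hat 1$. \end{enumerate} -/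

import Mathlib

universe u v

/-! ### Edge labelings and EL-shellability -/

section EL

variable {P : Type u} [PartialOrder P] {Λ : Type v} [PartialOrder Λ]

/-- `c` is a maximal chain `x ⋖ z₁ ⋖ ⋯ ⋖ zₜ ⋖ y` of the interval `[x, y]`, listed from bottom
to top. -/
def IsMaximalChain (x y : P) (c : List P) : Prop :=
  c.IsChain (· ⋖ ·) ∧ c.head? = some x ∧ c.getLast? = some y

/-- The word of labels read along a chain. -/
def chainWord (lab : P → P → Λ) (c : List P) : List Λ :=
  List.zipWith lab c c.tail

/-- A chain is increasing if its word is strictly increasing. -/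
def IsIncreasingChain (lab : P → P → Λ) (c : List P) : Prop :=
  (chainWord lab c).IsChain (· < ·)

/-- EL-labelings. Edge labelings are given as functions of two elements; only the values
`lab x y` with `x ⋖ y` are ever used. In every interval `[x, y]` there is a unique increasing
maximal chain, and its word strictly precedes the words of all other maximal chains in the
lexicographic order. -/
def IsELLabeling (lab : P → P → Λ) : Prop :=
  ∀ x y : P, x ≤ y → ∃ c : List P,
    IsMaximalChain x y c ∧ IsIncreasingChain lab c ∧
    ∀ c' : List P, IsMaximalChain x y c' → c' ≠ c →
      ¬ IsIncreasingChain lab c' ∧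
      List.Lex (· < ·) (chainWord lab c) (chainWord lab c')

end EL

/-- A poset is EL-shellable if it is bounded and admits an EL-labeling with labels in some
poset. -/
def IsELShellable (P : Type u) [PartialOrder P] : Prop :=
  (∃ b : P, IsBot b) ∧ (∃ t : P, IsTop t) ∧
    ∃ (Λ : Type u) (_ : PartialOrder Λ) (lab : P → P → Λ), IsELLabeling lab

/-! ### Labeled partitions -/

/-- The set `[[n]] = {1, 1̄, …, n, n̄}`: `(i, false)` is the number `i + 1` and `(i, true)` is its
barred copy. -/
abbrev SignedSet (n : ℕ) : Type := Fin n × Bool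

/-- The set of all barred elements of `X`. -/
def bar {n : ℕ} (X : Finset (SignedSet n)) : Finset (SignedSet n) :=
  X.image (fun p => (p.1, !p.2))

/-- An `S`-labeled partition of `[[n]]`: a partition of `[[n]]` into nonempty blocks, together with
an injective labeling of some of its blocks by signs. The labeling is recorded by its partial
inverse: `signedBlock σ` is the block with sign `σ`, and is empty if no block has sign `σ`. The set
of blocks is closed under the bar involution and a block is signed iff it equals its bar. -/
@[ext]
structure LabeledPartition (n : ℕ) (S : Type u) where
  blocks : Finpartition (Finset.univ : Finset (SignedSet n))
  signedBlock : S → Finset (SignedSet n)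
  signedBlock_mem : ∀ σ, (signedBlock σ).Nonempty → signedBlock σ ∈ blocks.parts
  signedBlock_inj : ∀ σ τ, (signedBlock σ).Nonempty → signedBlock σ = signedBlock τ → σ = τ
  bar_mem : ∀ R ∈ blocks.parts, bar R ∈ blocks.parts
  bar_eq_iff : ∀ R ∈ blocks.parts, bar R = R ↔ ∃ σ, signedBlock σ = R

namespace LabeledPartition

variable {n : ℕ} {S : Type u}

/-- Refinement: every block of `x` lies in a block of `y`, and the block of `x` with sign `σ` (if
there is one) lies in the block of `y` with the same sign. -/
instance instPartialOrder : PartialOrder (LabeledPartition n S) where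
  le x y := (∀ σ, x.signedBlock σ ⊆ y.signedBlock σ) ∧
    ∀ R ∈ x.blocks.parts, ∃ T ∈ y.blocks.parts, R ⊆ T
  le_refl x := ⟨fun _ => subset_rfl, fun R hR => ⟨R, hR, subset_rfl⟩⟩
  le_trans x y z h k := ⟨fun σ => (h.1 σ).trans (k.1 σ), fun R hR => by
    obtain ⟨T, hT, hRT⟩ := h.2 R hR
    obtain ⟨U, hU, hTU⟩ := k.2 T hT
    exact ⟨U, hU, hRT.trans hTU⟩⟩
  le_antisymm x y h k := by
    have hb : x.blocks = y.blocks :=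
      le_antisymm (fun R hR => h.2 R hR) (fun R hR => k.2 R hR)
    exact LabeledPartition.ext hb (funext fun σ => (h.1 σ).antisymm (k.1 σ))

/-- The sign `Σ(x)` of `x`: the set of all signs that occur in `x`. -/
def signs (x : LabeledPartition n S) : Set S := {σ | (x.signedBlock σ).Nonempty}

end LabeledPartition

/-! ### The four types of subposets -/

/-- The four infinite families. -/
inductive WeylFamily : Type
  | A
  | B
  | C
  | D

/-- The condition that defines the labeled partitions of type `A`, `B`, `C`, `D`, where `σ₀` is the
distinguished sign. In type `A` every block lies in `[n]` or in its bar, so that the partition is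
`R₁ | bar R₁ | ⋯ | Rₖ | bar Rₖ` with `R₁ | ⋯ | Rₖ` a partition of `[n]`. -/
def OfFamily {n : ℕ} {S : Type u} (σ₀ : S) : WeylFamily → LabeledPartition n S → Prop
  | .A, x => ∀ R ∈ x.blocks.parts, (∀ p ∈ R, p.2 = false) ∨ (∀ p ∈ R, p.2 = true)
  | .B, x => ∀ σ, σ ≠ σ₀ → (x.signedBlock σ).card ≠ 2
  | .C, _ => True
  | .D, x => ∀ σ, (x.signedBlock σ).card ≠ 2

/-- The labeled partitions of a given type, ordered by refinement, without the additional top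
element. Adding the top element gives `WithTop (FamilyPoset n σ₀ t)`. -/
abbrev FamilyPoset (n : ℕ) {S : Type u} (σ₀ : S) (t : WeylFamily) : Type u :=
  {x : LabeledPartition n S // OfFamily σ₀ t x}

/-! ### The edge labeling -/

/-- The representative of a block: the least `i ∈ {1, …, n}` such that `i` or its bar lies in
`R`. -/
noncomputable def representative {n : ℕ} (R : Finset (SignedSet n)) : ℕ :=
  sInf {i : ℕ | ∃ p ∈ R, (p.1 : ℕ) + 1 = i}

/-- A block is normalized if it contains its (unbarred) representative. -/
def IsNormalized {n : ℕ} (R : Finset (SignedSet n)) : Prop :=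
  ∃ p ∈ R, p.2 = false ∧ (p.1 : ℕ) + 1 = representative R

/-- `R` and `R'` are two distinct normalized unsigned blocks of `x`. -/
def IsNormalizedPair {n : ℕ} {S : Type u} (x : LabeledPartition n S)
    (R R' : Finset (SignedSet n)) : Prop :=
  R ≠ R' ∧ (R ∈ x.blocks.parts ∧ bar R ≠ R ∧ IsNormalized R) ∧
    (R' ∈ x.blocks.parts ∧ bar R' ≠ R' ∧ IsNormalized R')

open Classical in
/-- The label of an edge `x ⋖ y` between two labeled partitions. The first case is that of an edge
of sign `σ`, the second that of a coherent edge and the third that of a non-coherent edge; the last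
value is never taken on an edge. -/
noncomputable def partitionLabel {n : ℕ} {S : Type u} [LinearOrder S]
    (x y : LabeledPartition n S) : ℕ ×ₗ ℕ :=
  if h : ∃ σ, x.signedBlock σ ⊂ y.signedBlock σ then
    if h.choose ∈ x.signs then
      toLex (1, Set.ncard {τ | τ ∈ x.signs ∧ τ ≤ h.choose})
    else
      toLex (1, Set.ncard ({τ | τ ≤ h.choose} ∪ x.signs))
  else if h : ∃ q : Finset (SignedSet n) × Finset (SignedSet n),
      IsNormalizedPair x q.1 q.2 ∧ q.1 ∪ q.2 ∈ y.blocks.parts then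
    toLex (0, max (representative h.choose.1) (representative h.choose.2))
  else if h : ∃ q : Finset (SignedSet n) × Finset (SignedSet n),
      IsNormalizedPair x q.1 q.2 ∧ q.1 ∪ bar q.2 ∈ y.blocks.parts then
    toLex (2, min (representative h.choose.1) (representative h.choose.2))
  else toLex (0, 0)

/-- The edge labeling `λ` of the poset of all labeled partitions with a top element added: edges
that end in the top element have label `(1, 2)`. -/
noncomputable def edgeLabel {n : ℕ} {S : Type u} [LinearOrder S] :
    WithTop (LabeledPartition n S) → WithTop (LabeledPartition n S) → ℕ ×ₗ ℕ
  | (x : LabeledPartition n S), (y : LabeledPartition n S) => partitionLabel x y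
  | _, ⊤ => toLex (1, 2)
  | ⊤, _ => toLex (0, 0)

/-- The restriction of `λ` to the labeled partitions of a given type. -/
noncomputable def familyLabel {n : ℕ} {S : Type u} [LinearOrder S] {σ₀ : S} {t : WeylFamily}
    (x y : FamilyPoset n σ₀ t) : ℕ ×ₗ ℕ :=
  edgeLabel (x.1 : WithTop (LabeledPartition n S)) (y.1 : WithTop (LabeledPartition n S))

/-- The restriction of `λ` to the labeled partitions of a given type with the top element added. -/
noncomputable def familyLabelTop {n : ℕ} {S : Type u} [LinearOrder S] {σ₀ : S} {t : WeylFamily}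
    (x y : WithTop (FamilyPoset n σ₀ t)) : ℕ ×ₗ ℕ :=
  edgeLabel (x.map Subtype.val) (y.map Subtype.val)

/-! ### A local criterion for EL-labelings -/

section Criterion

variable {P : Type u} [PartialOrder P] {Λ : Type v}

/-! The EL property is reduced to conditions on two consecutive edges. In every interval [x, y] the
least label of an atom should be attained only once, the edges that follow the least atom should
have larger labels, and every atom z of non-least label should be followed by an edge inside [x, y]
whose label is at most that of x ⋖ z. Following least atoms then gives an increasing chain, and
every other chain fails to increase somewhere (`isELLabeling_of_goodInterval`).

To check these conditions, a labeled partition is encoded by the function sending i to its sign, or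
to its representative with or without a bar. Coarser means that the code factors through the finer
one. Covers are the substitutions `Step`: one representative j is replaced by a smaller
representative (coherent), by the bar of one (noncoherent), or by a sign. By `Step.le_iff` such a
step from a lies below b exactly when b gives j and its substitute the same value, so the atoms of
[a, b] are read off from coincidences among the values of b. Only two-element signed blocks can
obstruct a step in types B and D; they are avoided by merging coherently first (`exists_step_le`).

Coherent steps have the smallest labels. Hence, if the least atom is of another kind, b takes
distinct values on the representatives of a; this settles most cases. For consecutive sign steps
what matters is that adjoining a sign to the set in use raises the rank of another sign by 0 or 1
and never raises its own.

In intervals that end in ⊤ the label (1, 2) must exceed that of the last sign step of the increasing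
chain. With a single representative left, a sign step of label (1, 1) exists as soon as any sign
step does (`exists_label_eq_one`); this is where type B with n = 1 needs σ₀ to be least. -/

theorem isMaximalChain_self_iff {x : P} {c : List P} : IsMaximalChain x x c ↔ c = [x] := by
  constructor
  · rintro ⟨h1, h2, h3⟩
    match c, h1, h2, h3 with
    | [], _, h2, _ => simp at h2
    | [a], _, h2, _ => simpa using h2
    | a :: b :: l, h1, h2, h3 =>
      exfalso
      obtain rfl : a = x := by simpa using h2
      have h4 : (a :: b :: l).IsChain (· < ·) := h1.imp fun _ _ h => h.lt
      have h5 : a ∈ b :: l := by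
        rw [List.getLast?_cons_cons] at h3
        exact List.mem_of_getLast? h3
      exact lt_irrefl _ ((List.pairwise_cons.1 h4.pairwise).1 a h5)
  · rintro rfl
    exact ⟨by simp, by simp, by simp⟩

theorem isMaximalChain_cons {x y z : P} {l : List P} (hxz : x ⋖ z) (h : IsMaximalChain z y (z :: l)) :
    IsMaximalChain x y (x :: z :: l) :=
  ⟨List.isChain_cons_cons.2 ⟨hxz, h.1⟩, by simp, by simpa using h.2.2⟩

theorem IsMaximalChain.exists_cons {x y : P} {c : List P} (h : IsMaximalChain x y c) (hxy : x < y) :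
    ∃ z l, c = x :: z :: l ∧ x ⋖ z ∧ IsMaximalChain z y (z :: l) := by
  obtain ⟨h1, h2, h3⟩ := h
  match c, h1, h2, h3 with
  | [], _, h2, _ => simp at h2
  | [a], _, h2, h3 =>
    simp at h2 h3
    exact absurd (h2.symm.trans h3) hxy.ne
  | a :: b :: l, h1, h2, h3 =>
    obtain rfl : a = x := by simpa using h2
    rw [List.isChain_cons_cons] at h1
    exact ⟨b, l, rfl, h1.1, h1.2, by simp, by simpa using h3⟩

theorem IsMaximalChain.le {x y : P} {c : List P} (h : IsMaximalChain x y c) : x ≤ y := by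
  obtain ⟨h1, h2, h3⟩ := h
  match c, h1, h2, h3 with
  | [], _, h2, _ => simp at h2
  | a :: l, h1, h2, h3 =>
    obtain rfl : a = x := by simpa using h2
    have h4 : (a :: l).IsChain (· < ·) := h1.imp fun _ _ h => h.lt
    rcases List.mem_cons.1 (List.mem_of_getLast? h3) with h | h
    · exact h.ge
    · exact ((List.pairwise_cons.1 h4.pairwise).1 y h).le

theorem IsMaximalChain.head_eq {x y a : P} {l : List P} (h : IsMaximalChain x y (a :: l)) :
    a = x := by
  simpa using h.2.1

theorem IsMaximalChain.exists_eq_cons {x y : P} {c : List P} (h : IsMaximalChain x y c) :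
    ∃ l, c = x :: l := by
  match c, h with
  | [], h => simp [IsMaximalChain] at h
  | a :: l, h => exact ⟨l, by rw [h.head_eq]⟩

/-- The atom `z` of `[x, y]` has the least label among all atoms of `[x, y]`. -/
def IsMinAtom [LE Λ] (lab : P → P → Λ) (x y z : P) : Prop :=
  x ⋖ z ∧ z ≤ y ∧ ∀ w, x ⋖ w → w ≤ y → lab x z ≤ lab x w

/-- Local conditions on the labels of the atoms of `[x, y]`, and of the edges that follow them,
which guarantee an EL-labeling. -/
structure GoodInterval [Preorder Λ] (lab : P → P → Λ) (x y : P) : Prop where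
  uniq : ∀ z z', IsMinAtom lab x y z → x ⋖ z' → z' ≤ y → lab x z = lab x z' → z = z'
  inc : ∀ z w, IsMinAtom lab x y z → z ⋖ w → w ≤ y → lab x z < lab z w
  dec : ∀ z z', x ⋖ z → z ≤ y → x ⋖ z' → z' ≤ y → lab x z' < lab x z →
    ∃ w, z ⋖ w ∧ w ≤ y ∧ lab z w ≤ lab x z

/-- Downward induction on x: the increasing chain is the least atom z followed by the increasing
chain of [z, y]. -/
theorem isELLabeling_of_goodInterval [Finite P] [LinearOrder Λ] {lab : P → P → Λ}
    (h : ∀ x y, x < y → GoodInterval lab x y) : IsELLabeling lab := by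
  intro x y hxy
  -- The last clause is carried through the induction: it bounds the second label of a competing
  -- increasing chain.
  suffices H : ∃ c : List P, IsMaximalChain x y c ∧ IsIncreasingChain lab c ∧
      (∀ c' : List P, IsMaximalChain x y c' → c' ≠ c → ¬ IsIncreasingChain lab c' ∧
        List.Lex (· < ·) (chainWord lab c) (chainWord lab c')) ∧
      (∀ z l, c = x :: z :: l → IsMinAtom lab x y z) by
    obtain ⟨c, h1, h2, h3, -⟩ := H
    exact ⟨c, h1, h2, h3⟩
  induction x using (wellFounded_gt (α := P)).induction with
  | _ x ih =>
  rcases hxy.eq_or_lt with rfl | hlt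
  · refine ⟨[x], isMaximalChain_self_iff.2 rfl, by simp [IsIncreasingChain, chainWord], ?_, by simp⟩
    intro c' hc' hne
    exact absurd (isMaximalChain_self_iff.1 hc') hne
  obtain ⟨z, ⟨hxz, hzy⟩, hmin⟩ := Set.exists_min_image {w | x ⋖ w ∧ w ≤ y} (lab x)
    (Set.toFinite _) (exists_covBy_le_of_lt hlt)
  have hz : IsMinAtom lab x y z := ⟨hxz, hzy, fun w h1 h2 => hmin w ⟨h1, h2⟩⟩
  obtain ⟨c, hc, hinc, hother, hatom⟩ := ih z hxz.lt hzy
  obtain ⟨l, rfl⟩ := hc.exists_eq_cons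
  refine ⟨x :: z :: l, isMaximalChain_cons hxz hc, ?_, ?_, ?_⟩
  · match l, hc, hinc with
    | [], _, _ => simp [IsIncreasingChain, chainWord]
    | w :: l, hc, hinc =>
      have hzw : z ⋖ w := (List.isChain_cons_cons.1 hc.1).1
      have hwy : w ≤ y := by
        refine IsMaximalChain.le (c := w :: l) ⟨(List.isChain_cons_cons.1 hc.1).2, by simp, ?_⟩
        simpa using hc.2.2
      exact List.isChain_cons_cons.2 ⟨(h x y hlt).inc z w hz hzw hwy, hinc⟩
  · intro c' hc' hne
    obtain ⟨z', l', rfl, hxz', hl'⟩ := hc'.exists_cons hlt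
    have htail : ∀ m : List P, IsIncreasingChain lab (x :: z' :: m) →
        IsIncreasingChain lab (z' :: m) := by
      intro m hm
      exact List.IsChain.tail hm
    by_cases hzz : z' = z
    · subst hzz
      obtain ⟨h1, h2⟩ := hother (z' :: l') hl' (by simpa using hne)
      exact ⟨fun h3 => h1 (htail _ h3), List.Lex.cons h2⟩
    · have hlab : lab x z < lab x z' :=
        lt_of_le_of_ne (hz.2.2 z' hxz' hl'.le)
          fun he => hzz ((h x y hlt).uniq z z' hz hxz' hl'.le he).symm
      refine ⟨fun hi => ?_, List.Lex.rel hlab⟩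
      -- An increasing chain through z' must continue with the increasing chain of [z', y], hence
      -- with a least atom there; `dec` bounds its label by that of x ⋖ z'.
      obtain ⟨w, hw1, hw2, hw3⟩ := (h x y hlt).dec z' z hxz' hl'.le hxz hzy hlab
      obtain ⟨c2, hc2, -, hother2, hatom2⟩ := ih z' hxz'.lt hl'.le
      have hceq : z' :: l' = c2 := by
        by_contra hne2
        exact (hother2 _ hl' hne2).1 (htail _ hi)
      obtain ⟨w', m, hm, -, -⟩ := hl'.exists_cons (hw1.lt.trans_le hw2)
      obtain rfl : l' = w' :: m := by simpa using hm
      have h1 := (hatom2 w' m hceq.symm).2.2 w hw1 hw2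
      have h2 : lab x z' < lab z' w' := (List.isChain_cons_cons.1 hi).1
      exact absurd (h2.trans_le (h1.trans hw3)) (lt_irrefl _)
  · rintro z' l' he
    obtain ⟨rfl, -⟩ : z = z' ∧ l = l' := by simpa using he
    exact hz

theorem GoodInterval.congr_orderIso {Q : Type*} [PartialOrder Q] [Preorder Λ] (e : P ≃o Q)
    {lab : P → P → Λ} {lab' : Q → Q → Λ} (hlab : ∀ x y, lab x y = lab' (e x) (e y)) {x y : P}
    (h : GoodInterval lab' (e x) (e y)) : GoodInterval lab x y := by
  have hmin : ∀ z, IsMinAtom lab x y z → IsMinAtom lab' (e x) (e y) (e z) := by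
    rintro z ⟨h1, h2, h3⟩
    refine ⟨(apply_covBy_apply_iff e).2 h1, e.le_iff_le.2 h2, fun w hw1 hw2 => ?_⟩
    obtain ⟨w, rfl⟩ := e.surjective w
    simpa [hlab] using h3 w ((apply_covBy_apply_iff e).1 hw1) (e.le_iff_le.1 hw2)
  constructor
  · intro z z' hz hz1 hz2 he
    exact e.injective (h.uniq _ _ (hmin z hz) ((apply_covBy_apply_iff e).2 hz1)
      (e.le_iff_le.2 hz2) (by simpa [hlab] using he))
  · intro z w hz hw1 hw2
    simpa [hlab] using h.inc _ _ (hmin z hz) ((apply_covBy_apply_iff e).2 hw1) (e.le_iff_le.2 hw2)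
  · intro z z' h1 h2 h3 h4 h5
    obtain ⟨w, hw1, hw2, hw3⟩ := h.dec _ _ ((apply_covBy_apply_iff e).2 h1) (e.le_iff_le.2 h2)
      ((apply_covBy_apply_iff e).2 h3) (e.le_iff_le.2 h4) (by simpa [hlab] using h5)
    obtain ⟨w, rfl⟩ := e.surjective w
    exact ⟨w, (apply_covBy_apply_iff e).1 hw1, e.le_iff_le.1 hw2, by simpa [hlab] using hw3⟩

/-- Needed only to lift the labels into the universe of `P`, as `IsELShellable` requires. -/
theorem GoodInterval.comp_orderEmbedding {Λ' : Type*} [PartialOrder Λ] [PartialOrder Λ']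
    (f : Λ ↪o Λ') {lab : P → P → Λ} {x y : P} (h : GoodInterval lab x y) :
    GoodInterval (fun a b => f (lab a b)) x y := by
  have hmin : ∀ z, IsMinAtom (fun a b => f (lab a b)) x y z → IsMinAtom lab x y z := by
    rintro z ⟨h1, h2, h3⟩
    exact ⟨h1, h2, fun w hw1 hw2 => f.le_iff_le.1 (h3 w hw1 hw2)⟩
  constructor
  · intro z z' hz hz1 hz2 he
    exact h.uniq _ _ (hmin z hz) hz1 hz2 (f.injective he)
  · intro z w hz hw1 hw2
    exact f.lt_iff_lt.2 (h.inc _ _ (hmin z hz) hw1 hw2)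
  · intro z z' h1 h2 h3 h4 h5
    obtain ⟨w, hw1, hw2, hw3⟩ := h.dec _ _ h1 h2 h3 h4 (f.lt_iff_lt.1 h5)
    exact ⟨w, hw1, hw2, f.le_iff_le.2 hw3⟩

/-- Adjoining ⊤ does not change the interval [x, y] for y in `P`, so only intervals that end in ⊤
are new. -/
theorem GoodInterval.withTop [Preorder Λ] {lab : P → P → Λ} {labTop : WithTop P → WithTop P → Λ}
    (hlab : ∀ x y : P, labTop x y = lab x y) {x y : P} (h : GoodInterval lab x y) :
    GoodInterval labTop (x : WithTop P) (y : WithTop P) := by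
  have hmin : ∀ z : P, IsMinAtom labTop (x : WithTop P) y z → IsMinAtom lab x y z := by
    rintro z ⟨h1, h2, h3⟩
    refine ⟨WithTop.coe_covBy_coe.1 h1, WithTop.coe_le_coe.1 h2, fun w hw1 hw2 => ?_⟩
    simpa [hlab] using h3 w (WithTop.coe_covBy_coe.2 hw1) (WithTop.coe_le_coe.2 hw2)
  have hcoe : ∀ z : WithTop P, z ≤ y → ∃ z' : P, z = z' := by
    intro z hz
    cases z with
    | top => simp at hz
    | coe z => exact ⟨z, rfl⟩
  constructor
  · intro z z' hz hz1 hz2 he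
    obtain ⟨z, rfl⟩ := hcoe z hz.2.1
    obtain ⟨z', rfl⟩ := hcoe z' hz2
    rw [hlab, hlab] at he
    rw [h.uniq _ _ (hmin z hz) (WithTop.coe_covBy_coe.1 hz1) (WithTop.coe_le_coe.1 hz2) he]
  · intro z w hz hw1 hw2
    obtain ⟨z, rfl⟩ := hcoe z hz.2.1
    obtain ⟨w, rfl⟩ := hcoe w hw2
    rw [hlab, hlab]
    exact h.inc _ _ (hmin z hz) (WithTop.coe_covBy_coe.1 hw1) (WithTop.coe_le_coe.1 hw2)
  · intro z z' h1 h2 h3 h4 h5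
    obtain ⟨z, rfl⟩ := hcoe z h2
    obtain ⟨z', rfl⟩ := hcoe z' h4
    rw [hlab, hlab] at h5
    obtain ⟨w, hw1, hw2, hw3⟩ := h.dec _ _ (WithTop.coe_covBy_coe.1 h1) (WithTop.coe_le_coe.1 h2)
      (WithTop.coe_covBy_coe.1 h3) (WithTop.coe_le_coe.1 h4) h5
    exact ⟨w, WithTop.coe_covBy_coe.2 hw1, WithTop.coe_le_coe.2 hw2, by simpa [hlab] using hw3⟩

end Criterion

/-! ### Codes of labeled partitions and their covering relation -/

section Codes

variable {n : ℕ} {S : Type u}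

/-- Barring a value (if `e` is `true`) fixes the signs. -/
def twist (e : Bool) : SignedSet n ⊕ S → SignedSet n ⊕ S
  | .inl (i, d) => .inl (i, xor e d)
  | .inr σ => .inr σ

@[simp] theorem twist_inl (e d : Bool) (i : Fin n) :
    twist e (.inl (i, d) : SignedSet n ⊕ S) = .inl (i, xor e d) := rfl

@[simp] theorem twist_inr (e : Bool) (σ : S) :
    twist e (.inr σ : SignedSet n ⊕ S) = .inr σ := rfl

@[simp] theorem twist_false (v : SignedSet n ⊕ S) : twist false v = v := by
  rcases v with ⟨i, d⟩ | σ <;> simp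

theorem twist_twist (e d : Bool) (v : SignedSet n ⊕ S) :
    twist e (twist d v) = twist (xor e d) v := by
  rcases v with ⟨i, c⟩ | σ <;> simp

@[simp] theorem twist_self (e : Bool) (v : SignedSet n ⊕ S) : twist e (twist e v) = v := by
  rw [twist_twist]; simp

@[simp] theorem twist_eq_inr {e : Bool} {v : SignedSet n ⊕ S} {σ : S} :
    twist e v = .inr σ ↔ v = .inr σ := by
  rcases v with ⟨i, c⟩ | τ <;> simp

theorem twist_injective (e : Bool) :
    Function.Injective (twist e : SignedSet n ⊕ S → SignedSet n ⊕ S) :=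
  Function.LeftInverse.injective (twist_self e)

theorem eq_inr_of_twist_true_eq {v : SignedSet n ⊕ S} (h : twist true v = v) :
    ∃ σ, v = .inr σ := by
  rcases v with ⟨i, c⟩ | τ
  · cases c <;> simp at h
  · exact ⟨τ, rfl⟩

/-- A labeled partition, encoded by the function that sends `i` to the sign of its block if there
is one, and otherwise to `r` or its bar, where `r` is the representative of the block of `i`,
according as `i` lies in the block of `r` or in the block of the bar of `r`. -/
@[ext]
structure PartitionCode (n : ℕ) (S : Type u) where
  val : Fin n → SignedSet n ⊕ S
  le_of_val : ∀ {i r e}, val i = .inl (r, e) → r ≤ i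
  val_of_val : ∀ {i r e}, val i = .inl (r, e) → val r = .inl (r, false)

namespace PartitionCode

/-- The extension of the encoding function to all of `[[n]]` and to the signs. -/
def ext' (a : PartitionCode n S) : SignedSet n ⊕ S → SignedSet n ⊕ S
  | .inl (i, e) => twist e (a.val i)
  | .inr σ => .inr σ

@[simp] theorem ext'_inl (a : PartitionCode n S) (i : Fin n) (e : Bool) :
    a.ext' (.inl (i, e)) = twist e (a.val i) := rfl

@[simp] theorem ext'_inr (a : PartitionCode n S) (σ : S) : a.ext' (.inr σ) = .inr σ := rfl

theorem ext'_twist (a : PartitionCode n S) (e : Bool) (v : SignedSet n ⊕ S) :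
    a.ext' (twist e v) = twist e (a.ext' v) := by
  rcases v with ⟨i, d⟩ | σ <;> simp [twist_twist]

theorem ext'_val (a : PartitionCode n S) (i : Fin n) : a.ext' (a.val i) = a.val i := by
  rcases h : a.val i with ⟨r, e⟩ | σ
  · simp [a.val_of_val h]
  · rfl

/-- `j` is the representative of an unsigned block. -/
def IsRep (a : PartitionCode n S) (j : Fin n) : Prop := a.val j = .inl (j, false)

/-- The set of signs that occur. -/
def signs (a : PartitionCode n S) : Set S := {σ | ∃ i, a.val i = .inr σ}

theorem ext'_ext'_of_forall {a b : PartitionCode n S} (h : ∀ i, b.ext' (a.val i) = b.val i)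
    (v : SignedSet n ⊕ S) : b.ext' (a.ext' v) = b.ext' v := by
  rcases v with ⟨i, e⟩ | σ
  · simp [ext'_twist, h]
  · rfl

theorem val_eq_inr_of_forall {a b : PartitionCode n S} (h : ∀ i, b.ext' (a.val i) = b.val i)
    {i : Fin n} {σ : S} (hi : a.val i = .inr σ) : b.val i = .inr σ := by
  rw [← h, hi]; rfl

/-- Signed blocks stay signed under coarsening, and merging can only lower representatives. The
hypothesis is spelled out because the order is defined only afterwards. -/
theorem exists_val_of_forall {a b : PartitionCode n S} (h : ∀ i, b.ext' (a.val i) = b.val i)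
    {i s : Fin n} {f : Bool} (hi : b.val i = .inl (s, f)) :
    ∃ r e, a.val i = .inl (r, e) ∧ s ≤ r := by
  rcases ha : a.val i with ⟨r, e⟩ | σ
  · refine ⟨r, e, rfl, ?_⟩
    have h1 := h i
    rw [ha, hi, ext'_inl] at h1
    rcases hr : b.val r with ⟨s', f'⟩ | σ
    · rw [hr] at h1
      have : s' = s := by
        simp at h1
        exact h1.1
      exact this ▸ b.le_of_val hr
    · simp [hr] at h1
  · rw [val_eq_inr_of_forall h ha] at hi
    simp at hi

instance : PartialOrder (PartitionCode n S) where
  le a b := ∀ i, b.ext' (a.val i) = b.val i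
  le_refl a i := a.ext'_val i
  le_trans a b c h k i := by rw [← k i, ← h i, ext'_ext'_of_forall k]
  le_antisymm a b h k := by
    ext1
    funext i
    rcases hb : b.val i with ⟨s, f⟩ | σ
    · obtain ⟨r, e, ha, hsr⟩ := exists_val_of_forall h hb
      obtain ⟨s', f', hb', hrs⟩ := exists_val_of_forall k ha
      obtain ⟨rfl, rfl⟩ : s = s' ∧ f = f' := by simpa [hb] using hb'
      obtain rfl := le_antisymm hsr hrs
      have h1 := h i
      rw [ha, hb, ext'_inl, b.val_of_val hb] at h1
      simpa [ha] using h1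
    · exact val_eq_inr_of_forall k hb

theorem ext'_ext'_of_le {a b : PartitionCode n S} (h : a ≤ b) (v : SignedSet n ⊕ S) :
    b.ext' (a.ext' v) = b.ext' v := ext'_ext'_of_forall h v

theorem isRep_of_le {a b : PartitionCode n S} (h : a ≤ b) {i : Fin n} (hi : b.IsRep i) :
    a.IsRep i := by
  obtain ⟨r, e, ha, hir⟩ := exists_val_of_forall h hi
  obtain rfl := le_antisymm hir (a.le_of_val ha)
  exact a.val_of_val ha

theorem isRep_of_val {a : PartitionCode n S} {i r : Fin n} {e : Bool}
    (h : a.val i = .inl (r, e)) : a.IsRep r := a.val_of_val h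

/-- The values of b are determined by the code a and the values of b at the representatives of a.
The set of representatives thus serves as a rank. -/
theorem eq_of_le_of_isRep {a b : PartitionCode n S} (h : a ≤ b)
    (hrep : ∀ i, a.IsRep i → b.IsRep i) : a = b := by
  ext1
  funext i
  have h1 := h i
  rcases ha : a.val i with ⟨r, e⟩ | σ
  · rw [ha, ext'_inl, hrep r (a.val_of_val ha)] at h1
    simpa using h1
  · simpa [ha] using h1

theorem finite [Finite S] : Finite (PartitionCode n S) :=
  Finite.of_injective PartitionCode.val fun _ _ h => PartitionCode.ext h

/-- The substitution of `v` for `j`. -/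
def subst (j : Fin n) (v : SignedSet n ⊕ S) : SignedSet n ⊕ S → SignedSet n ⊕ S
  | .inl (k, e) => if k = j then twist e v else .inl (k, e)
  | .inr σ => .inr σ

/-- `c` arises from `a` by substituting `v` for the representative `j`, that is by merging the
block of `j` into another one. -/
structure Step (a : PartitionCode n S) (j : Fin n) (v : SignedSet n ⊕ S) (c : PartitionCode n S) :
    Prop where
  isRep : a.IsRep j
  adm : ∀ {i e}, v = .inl (i, e) → i < j ∧ a.IsRep i
  val_eq : ∀ k, c.val k = subst j v (a.val k)

/-- The condition on v keeps the result a code: the new representative i lies below j, is a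
representative of a, and is not itself replaced. -/
theorem exists_step {a : PartitionCode n S} {j : Fin n} {v : SignedSet n ⊕ S} (hj : a.IsRep j)
    (hv : ∀ {i e}, v = .inl (i, e) → i < j ∧ a.IsRep i) : ∃ c, Step a j v c := by
  have key : ∀ {k r e}, subst j v (a.val k) = .inl (r, e) → r ≤ k ∧ a.IsRep r ∧ r ≠ j := by
    intro k r e hk
    rcases ha : a.val k with ⟨s, f⟩ | σ
    · rw [ha, subst] at hk
      split_ifs at hk with hs
      · subst hs
        rcases v with ⟨i, d⟩ | σ
        · obtain ⟨h1, h2⟩ := hv rfl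
          obtain ⟨rfl, -⟩ : i = r ∧ _ := by simpa using hk
          exact ⟨h1.le.trans (a.le_of_val ha), h2, h1.ne⟩
        · simp at hk
      · obtain ⟨rfl, -⟩ : s = r ∧ _ := by simpa using hk
        exact ⟨a.le_of_val ha, a.val_of_val ha, hs⟩
    · simp [ha, subst] at hk
  refine ⟨⟨fun k => subst j v (a.val k), fun h => (key h).1, fun h => ?_⟩, hj, hv, fun _ => rfl⟩
  obtain ⟨-, h1, h2⟩ := key h
  simp only [IsRep] at h1
  simp [h1, subst, h2]

namespace Step

variable {a b c : PartitionCode n S} {j : Fin n} {v : SignedSet n ⊕ S}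

theorem val_self (h : Step a j v c) : c.val j = v := by
  rw [h.val_eq, h.isRep]; simp [subst]

/-- The universal property of merging: c is the finest coarsening of a in which j and v have the
same value. -/
theorem le_iff (h : Step a j v c) : c ≤ b ↔ a ≤ b ∧ b.ext' v = b.val j := by
  have hac : ∀ k, b.ext' v = b.val j → b.ext' (c.val k) = b.ext' (a.val k) := by
    intro k hb
    rw [h.val_eq]
    rcases a.val k with ⟨r, e⟩ | σ
    · rw [subst]
      split_ifs with hr
      · rw [ext'_twist, hb, hr, ext'_inl]
      · rfl
    · rfl
  constructor
  · intro hcb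
    have h1 : b.ext' v = b.val j := by rw [← h.val_self, hcb]
    exact ⟨fun k => by rw [← hac k h1, hcb], h1⟩
  · rintro ⟨hab, h1⟩ k
    rw [hac k h1, hab]

theorem le (h : Step a j v c) : a ≤ c := (h.le_iff.1 le_rfl).1

theorem isRep_iff (h : Step a j v c) {k : Fin n} : c.IsRep k ↔ a.IsRep k ∧ k ≠ j := by
  constructor
  · intro hk
    refine ⟨isRep_of_le h.le hk, ?_⟩
    rintro rfl
    rw [IsRep, h.val_self] at hk
    exact (h.adm hk).1.ne rfl
  · rintro ⟨h1, h2⟩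
    rw [IsRep] at h1
    rw [IsRep, h.val_eq, h1, subst, if_neg h2]

theorem lt (h : Step a j v c) : a < c := by
  refine h.le.lt_of_ne ?_
  rintro rfl
  exact (h.isRep_iff.1 h.isRep).2 rfl

/-- A step loses exactly one representative, which leaves no room for anything strictly between. -/
theorem eq_of_lt_of_le (h : Step a j v c) (h1 : a < b) (h2 : b ≤ c) : b = c := by
  refine eq_of_le_of_isRep h2 fun i hi => h.isRep_iff.2 ⟨isRep_of_le h1.le hi, ?_⟩
  rintro rfl
  refine h1.ne (eq_of_le_of_isRep h1.le fun k hk => ?_)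
  by_cases hki : k = i
  · exact hki ▸ hi
  · exact isRep_of_le h2 (h.isRep_iff.2 ⟨hk, hki⟩)

theorem unique {c' : PartitionCode n S} (h : Step a j v c) (h' : Step a j v c') : c = c' := by
  ext1
  funext k
  rw [h.val_eq, h'.val_eq]

theorem val_eq_inr (h : Step a j v c) {k : Fin n} {σ : S} (hk : a.val k = .inr σ) :
    c.val k = .inr σ := val_eq_inr_of_forall h.le hk

theorem val_inr_iff {τ : S} (h : Step a j (.inr τ) c) {k : Fin n} {σ : S} :
    c.val k = .inr σ ↔ a.val k = .inr σ ∨ (σ = τ ∧ ∃ e, a.val k = .inl (j, e)) := by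
  rw [h.val_eq]
  rcases a.val k with ⟨r, e⟩ | ρ
  · rw [subst]
    split_ifs with hr
    · simp [hr, eq_comm]
    · simp [hr]
  · simp [subst]

theorem val_inr_iff_of_inl {p : SignedSet n} (h : Step a j (.inl p) c) {k : Fin n} {σ : S} :
    c.val k = .inr σ ↔ a.val k = .inr σ := by
  rw [h.val_eq]
  rcases a.val k with ⟨r, e⟩ | ρ
  · rw [subst]
    split_ifs with hr <;> simp
  · simp [subst]

theorem signs_inr {τ : S} (h : Step a j (.inr τ) c) : c.signs = insert τ a.signs := by
  ext σ
  simp only [signs, Set.mem_ofPred_eq, h.val_inr_iff, Set.mem_insert_iff]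
  constructor
  · rintro ⟨i, hi | hi⟩
    · exact Or.inr ⟨i, hi⟩
    · exact Or.inl hi.1
  · rintro (rfl | ⟨i, hi⟩)
    · exact ⟨j, Or.inr ⟨rfl, false, h.isRep⟩⟩
    · exact ⟨i, Or.inl hi⟩

end Step

theorem exists_isRep_of_lt {a b : PartitionCode n S} (h : a < b) :
    ∃ j, a.IsRep j ∧ ¬ b.IsRep j := by
  by_contra! H
  exact h.ne (eq_of_le_of_isRep h.le H)

theorem isRep_of_val_eq_inl {a b : PartitionCode n S} (h : a ≤ b) {j i : Fin n} {e : Bool}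
    (hj : ¬ b.IsRep j) (hb : b.val j = .inl (i, e)) : i < j ∧ a.IsRep i := by
  refine ⟨(b.le_of_val hb).lt_of_ne ?_, isRep_of_le h (isRep_of_val hb)⟩
  rintro rfl
  exact hj (isRep_of_val hb)

/-! ### The four families -/

/-- The signs that may not occur on blocks with two elements. -/
def Restricted (σ₀ : S) : WeylFamily → S → Prop
  | .B, σ => σ ≠ σ₀
  | .D, _ => True
  | _, _ => False

/-- The codes of the labeled partitions of a given type. -/
def InFamily (σ₀ : S) (t : WeylFamily) (a : PartitionCode n S) : Prop :=
  (t = .A → ∀ i, ∃ r, a.val i = .inl (r, false)) ∧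
  ∀ σ i, Restricted σ₀ t σ → a.val i = .inr σ → ∃ k, k ≠ i ∧ a.val k = .inr σ

variable {σ₀ : S} {t : WeylFamily} {a b c : PartitionCode n S}

theorem InFamily.of_coherent (ha : a.InFamily σ₀ t) {i j : Fin n}
    (h : Step a j (.inl (i, false)) c) : c.InFamily σ₀ t := by
  refine ⟨fun ht k => ?_, fun σ k hσ hk => ?_⟩
  · obtain ⟨r, hr⟩ := ha.1 ht k
    rw [h.val_eq, hr, subst]
    split_ifs
    · exact ⟨i, rfl⟩
    · exact ⟨r, rfl⟩
  · obtain ⟨l, hl, hl2⟩ := ha.2 σ k hσ (h.val_inr_iff_of_inl.1 hk)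
    exact ⟨l, hl, h.val_inr_iff_of_inl.2 hl2⟩

theorem InFamily.of_inl (ha : a.InFamily σ₀ t) (ht : t ≠ .A) {j : Fin n} {p : SignedSet n}
    (h : Step a j (.inl p) c) : c.InFamily σ₀ t := by
  refine ⟨fun ht' => absurd ht' ht, fun σ k hσ hk => ?_⟩
  obtain ⟨l, hl, hl2⟩ := ha.2 σ k hσ (h.val_inr_iff_of_inl.1 hk)
  exact ⟨l, hl, h.val_inr_iff_of_inl.2 hl2⟩

theorem InFamily.of_inr (ha : a.InFamily σ₀ t) (ht : t ≠ .A) {j : Fin n} {σ : S}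
    (h : Step a j (.inr σ) c)
    (hσ : Restricted σ₀ t σ → ∃ k, k ≠ j ∧ c.val k = .inr σ) : c.InFamily σ₀ t := by
  refine ⟨fun ht' => absurd ht' ht, fun τ k hτ hk => ?_⟩
  rcases h.val_inr_iff.1 hk with h1 | ⟨rfl, -⟩
  · obtain ⟨l, hl, hl2⟩ := ha.2 τ k hτ h1
    exact ⟨l, hl, h.val_eq_inr hl2⟩
  · obtain ⟨l, hl, hl2⟩ := hσ hτ
    by_cases hlk : l = k
    · exact ⟨j, hlk ▸ hl.symm, h.val_self⟩
    · exact ⟨l, hlk, hl2⟩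

theorem InFamily.ne_A_of_inr (hb : b.InFamily σ₀ t) {i : Fin n} {σ : S} (h : b.val i = .inr σ) :
    t ≠ .A := by
  intro ht
  obtain ⟨r, hr⟩ := hb.1 ht i
  simp [h] at hr

theorem InFamily.ne_A_of_inl (hb : b.InFamily σ₀ t) {i r : Fin n}
    (h : b.val i = .inl (r, true)) : t ≠ .A := by
  intro ht
  obtain ⟨r, hr⟩ := hb.1 ht i
  simp [h] at hr

theorem InFamily.ne_A_of_twist (hb : b.InFamily σ₀ t) {i j : Fin n}
    (h : twist true (b.val i) = b.val j) : t ≠ .A := by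
  intro ht
  obtain ⟨r, hr⟩ := hb.1 ht i
  obtain ⟨s, hs⟩ := hb.1 ht j
  simp [hr, hs] at h

theorem exists_coherent (ha : a.InFamily σ₀ t) {i j : Fin n} (hi : a.IsRep i) (hj : a.IsRep j)
    (hij : i < j) : ∃ c, Step a j (.inl (i, false)) c ∧ c.InFamily σ₀ t := by
  obtain ⟨c, hc⟩ := exists_step (a := a) (j := j) (v := .inl (i, false)) hj
    (fun h => by simp at h; exact h.1 ▸ ⟨hij, hi⟩)
  exact ⟨c, hc, ha.of_coherent hc⟩

theorem exists_noncoherent (ha : a.InFamily σ₀ t) (ht : t ≠ .A) {i j : Fin n} (hi : a.IsRep i)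
    (hj : a.IsRep j) (hij : i < j) :
    ∃ c, Step a j (.inl (i, true)) c ∧ c.InFamily σ₀ t := by
  obtain ⟨c, hc⟩ := exists_step (a := a) (j := j) (v := .inl (i, true)) hj
    (fun h => by simp at h; exact h.1 ▸ ⟨hij, hi⟩)
  exact ⟨c, hc, ha.of_inl ht hc⟩

theorem exists_sign (ha : a.InFamily σ₀ t) (ht : t ≠ .A) {j : Fin n} (hj : a.IsRep j) {σ : S}
    (hσ : Restricted σ₀ t σ →
      ∃ k, k ≠ j ∧ (a.val k = .inr σ ∨ ∃ e, a.val k = .inl (j, e))) :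
    ∃ c, Step a j (.inr σ) c ∧ c.InFamily σ₀ t := by
  obtain ⟨c, hc⟩ := exists_step (a := a) (j := j) (v := .inr σ) hj (fun h => by simp at h)
  refine ⟨c, hc, ha.of_inr ht hc fun hr => ?_⟩
  obtain ⟨k, hk, hk2⟩ := hσ hr
  exact ⟨k, hk, hc.val_inr_iff.2 (hk2.imp_right fun h => ⟨rfl, h⟩)⟩

/-- A sign in use already occurs at an index other than j, so enlarging its block cannot create a
two-element block. -/
theorem exists_sign_of_mem (ha : a.InFamily σ₀ t) {j : Fin n} (hj : a.IsRep j) {σ : S}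
    (hσ : σ ∈ a.signs) : ∃ c, Step a j (.inr σ) c ∧ c.InFamily σ₀ t := by
  obtain ⟨i, hi⟩ := hσ
  refine exists_sign ha (ha.ne_A_of_inr hi) hj fun _ => ⟨i, ?_, Or.inl hi⟩
  rintro rfl
  simp [IsRep, hi] at hj

/-- Under uniqueness the σ-block after the step is already that of b, which satisfies the size
restriction. -/
theorem exists_sign_of_unique (ha : a.InFamily σ₀ t) (hb : b.InFamily σ₀ t) (hab : a ≤ b)
    {j : Fin n} (hj : a.IsRep j) {σ : S} (hσ : b.val j = .inr σ)
    (huniq : ∀ k, a.IsRep k → b.val k = .inr σ → k = j) :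
    ∃ c, Step a j (.inr σ) c ∧ c.InFamily σ₀ t := by
  refine exists_sign ha (hb.ne_A_of_inr hσ) hj fun hr => ?_
  obtain ⟨k, hk, hk2⟩ := hb.2 σ j hr hσ
  refine ⟨k, hk, ?_⟩
  have h1 := hab k
  rcases hak : a.val k with ⟨r, e⟩ | τ
  · right
    rw [hak, hk2, ext'_inl, twist_eq_inr] at h1
    exact ⟨e, by rw [huniq r (isRep_of_val hak) h1]⟩
  · left
    simpa [hak, hk2] using h1

/-- Let j be a representative of a that b loses. If b gives it a sign σ, either j is the only such
representative and the sign step is allowed, or two such representatives can be merged coherently. A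
barred or signed value in b rules out type A. -/
theorem exists_step_le (ha : a.InFamily σ₀ t) (hb : b.InFamily σ₀ t) (hab : a < b) :
    ∃ j v c, Step a j v c ∧ c.InFamily σ₀ t ∧ c ≤ b := by
  obtain ⟨j, hj, hbj⟩ := exists_isRep_of_lt hab
  rcases hv : b.val j with ⟨i, e⟩ | σ
  · obtain ⟨hij, hi⟩ := isRep_of_val_eq_inl hab.le hbj hv
    obtain ⟨c, hc, hcF⟩ : ∃ c, Step a j (.inl (i, e)) c ∧ c.InFamily σ₀ t := by
      cases e
      · exact exists_coherent ha hi hj hij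
      · exact exists_noncoherent ha (hb.ne_A_of_inl hv) hi hj hij
    refine ⟨j, _, c, hc, hcF, hc.le_iff.2 ⟨hab.le, ?_⟩⟩
    rw [← hv, ext'_val]
  · by_cases H : ∀ k, a.IsRep k → b.val k = .inr σ → k = j
    · obtain ⟨c, hc, hcF⟩ := exists_sign_of_unique ha hb hab.le hj hv H
      exact ⟨j, _, c, hc, hcF, hc.le_iff.2 ⟨hab.le, hv.symm⟩⟩
    · push Not at H
      obtain ⟨k, hk, hk2, hkj⟩ := H
      rcases hkj.lt_or_gt with h | h
      · obtain ⟨c, hc, hcF⟩ := exists_coherent ha hk hj h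
        exact ⟨j, _, c, hc, hcF, hc.le_iff.2 ⟨hab.le, by simp [hv, hk2]⟩⟩
      · obtain ⟨c, hc, hcF⟩ := exists_coherent ha hj hk h
        exact ⟨k, _, c, hc, hcF, hc.le_iff.2 ⟨hab.le, by simp [hv, hk2]⟩⟩

theorem covBy_iff {a c : {x : PartitionCode n S // x.InFamily σ₀ t}} :
    a ⋖ c ↔ ∃ j v, Step a.1 j v c.1 := by
  constructor
  · intro h
    obtain ⟨j, v, d, hd, hdF, hdc⟩ := exists_step_le a.2 c.2 h.lt
    have : (⟨d, hdF⟩ : {x : PartitionCode n S // x.InFamily σ₀ t}) = c :=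
      (h.eq_or_eq (c := ⟨d, hdF⟩) hd.le hdc).resolve_left
        fun he => hd.lt.ne (congrArg Subtype.val he).symm
    exact ⟨j, v, by rw [← this]; exact hd⟩
  · rintro ⟨j, v, h⟩
    refine ⟨h.lt, fun d h1 h2 => h2.ne (Subtype.ext (h.eq_of_lt_of_le h1 h2.le))⟩

end PartitionCode

end Codes

/-! ### How ranks of signs vary with the set of signs in use -/

section SignRank

variable {S : Type u} [LinearOrder S]

open Classical in
/-- The rank of the sign `σ` in the labels, where `T` is the set of signs in use. -/
noncomputable def signRank (T : Set S) (σ : S) : ℕ :=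
  if σ ∈ T then Set.ncard {τ | τ ∈ T ∧ τ ≤ σ} else Set.ncard ({τ | τ ≤ σ} ∪ T)

theorem signRank_of_mem {T : Set S} {σ : S} (h : σ ∈ T) :
    signRank T σ = Set.ncard {τ | τ ∈ T ∧ τ ≤ σ} := if_pos h

theorem signRank_of_notMem {T : Set S} {σ : S} (h : σ ∉ T) :
    signRank T σ = Set.ncard ({τ | τ ≤ σ} ∪ T) := if_neg h

theorem signRank_empty_of_forall_le {σ : S} (h : ∀ τ, σ ≤ τ) : signRank (∅ : Set S) σ = 1 := by
  rw [signRank_of_notMem (Set.notMem_empty _), Set.ncard_eq_one]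
  refine ⟨σ, Set.ext fun τ => ?_⟩
  simpa using ⟨fun hτ => le_antisymm hτ (h τ), fun hτ => hτ.le⟩

variable [Finite S]

theorem signRank_lt_of_mem_of_notMem {T : Set S} {σ τ : S} (hσ : σ ∈ T) (hτ : τ ∉ T) :
    signRank T σ < signRank T τ := by
  rw [signRank_of_mem hσ, signRank_of_notMem hτ]
  refine Set.ncard_lt_ncard ?_ (Set.toFinite _)
  exact ⟨fun ρ hρ => Or.inr hρ.1, fun h => hτ (h (Or.inl le_rfl)).1⟩

theorem signRank_lt_of_lt {T : Set S} {σ τ : S} (h : σ < τ) (hT : σ ∈ T ↔ τ ∈ T) :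
    signRank T σ < signRank T τ := by
  by_cases hσ : σ ∈ T
  · rw [signRank_of_mem hσ, signRank_of_mem (hT.1 hσ)]
    refine Set.ncard_lt_ncard ?_ (Set.toFinite _)
    exact ⟨fun ρ hρ => ⟨hρ.1, hρ.2.trans h.le⟩, fun h' => h.not_ge (h' ⟨hT.1 hσ, le_rfl⟩).2⟩
  · have hτ : τ ∉ T := fun h' => hσ (hT.2 h')
    rw [signRank_of_notMem hσ, signRank_of_notMem hτ]
    refine Set.ncard_lt_ncard ?_ (Set.toFinite _)
    refine ⟨fun ρ hρ => hρ.imp_left fun h' => le_trans h' h.le, fun h' => ?_⟩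
    rcases h' (Or.inl le_rfl : τ ∈ {ρ | ρ ≤ τ} ∪ T) with h1 | h1
    · exact h.not_ge h1
    · exact hτ h1

/-- Signs in use come before all others, and within each of the two classes the rank is strictly
monotone. -/
theorem signRank_injective (T : Set S) : Function.Injective (signRank T) := by
  intro σ τ h
  by_cases hσ : σ ∈ T <;> by_cases hτ : τ ∈ T
  · rcases lt_trichotomy σ τ with h1 | h1 | h1
    · exact absurd h (signRank_lt_of_lt h1 (by simp [hσ, hτ])).ne
    · exact h1
    · exact absurd h (signRank_lt_of_lt h1 (by simp [hσ, hτ])).ne'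
  · exact absurd h (signRank_lt_of_mem_of_notMem hσ hτ).ne
  · exact absurd h (signRank_lt_of_mem_of_notMem hτ hσ).ne'
  · rcases lt_trichotomy σ τ with h1 | h1 | h1
    · exact absurd h (signRank_lt_of_lt h1 (by simp [hσ, hτ])).ne
    · exact h1
    · exact absurd h (signRank_lt_of_lt h1 (by simp [hσ, hτ])).ne'

theorem signRank_pos (T : Set S) (σ : S) : 0 < signRank T σ := by
  by_cases hσ : σ ∈ T
  · rw [signRank_of_mem hσ, Set.ncard_pos (Set.toFinite _)]
    exact ⟨σ, hσ, le_rfl⟩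
  · rw [signRank_of_notMem hσ, Set.ncard_pos (Set.toFinite _)]
    exact ⟨σ, Or.inl le_rfl⟩

theorem signRank_le_insert {T : Set S} {σ τ : S} (h : σ ≠ τ) :
    signRank T τ ≤ signRank (insert σ T) τ := by
  by_cases hτ : τ ∈ T
  · rw [signRank_of_mem hτ, signRank_of_mem (Set.mem_insert_of_mem _ hτ)]
    exact Set.ncard_le_ncard (fun ρ hρ => ⟨Or.inr hρ.1, hρ.2⟩) (Set.toFinite _)
  · rw [signRank_of_notMem hτ, signRank_of_notMem (by simp [h.symm, hτ])]
    exact Set.ncard_le_ncard (fun ρ hρ => hρ.imp_right Or.inr) (Set.toFinite _)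

theorem signRank_insert_le_succ {T : Set S} {σ τ : S} (h : σ ≠ τ) :
    signRank (insert σ T) τ ≤ signRank T τ + 1 := by
  by_cases hτ : τ ∈ T
  · rw [signRank_of_mem hτ, signRank_of_mem (Set.mem_insert_of_mem _ hτ)]
    refine (Set.ncard_le_ncard (t := insert σ {ρ | ρ ∈ T ∧ ρ ≤ τ}) ?_ (Set.toFinite _)).trans
      (Set.ncard_insert_le _ _)
    rintro ρ ⟨hρ | hρ, hρ2⟩
    · exact Or.inl hρ
    · exact Or.inr ⟨hρ, hρ2⟩
  · rw [signRank_of_notMem hτ, signRank_of_notMem (by simp [h.symm, hτ])]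
    refine (Set.ncard_le_ncard (t := insert σ ({ρ | ρ ≤ τ} ∪ T)) ?_ (Set.toFinite _)).trans
      (Set.ncard_insert_le _ _)
    rintro ρ (hρ | hρ | hρ)
    · exact Or.inr (Or.inl hρ)
    · exact Or.inl hρ
    · exact Or.inr (Or.inr hρ)

/-- Lets a second block join a sign that has just been introduced, without an increase of the label.
-/
theorem signRank_insert_self_le (T : Set S) (σ : S) :
    signRank (insert σ T) σ ≤ signRank T σ := by
  rw [signRank_of_mem (Set.mem_insert _ _)]
  by_cases hσ : σ ∈ T
  · rw [signRank_of_mem hσ, Set.insert_eq_of_mem hσ]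
  · rw [signRank_of_notMem hσ]
    exact Set.ncard_le_ncard (fun ρ hρ => Or.inl hρ.2) (Set.toFinite _)

theorem exists_signRank_eq_one {T : Set S} (h : T.Nonempty) : ∃ σ ∈ T, signRank T σ = 1 := by
  obtain ⟨σ, hσ, hmin⟩ := Set.exists_min_image T id (Set.toFinite _) h
  refine ⟨σ, hσ, ?_⟩
  rw [signRank_of_mem hσ, Set.ncard_eq_one]
  exact ⟨σ, Set.ext fun τ => ⟨fun hτ => le_antisymm hτ.2 (hmin τ hτ.1),
    fun hτ => by rw [Set.mem_singleton_iff.1 hτ]; exact ⟨hσ, le_rfl⟩⟩⟩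

end SignRank

/-! ### Labels of steps and intervals between labeled partitions -/

namespace PartitionCode

variable {n : ℕ} {S : Type u} [LinearOrder S]

/-- The label of the edge from `a` that substitutes `v` for `j`. -/
noncomputable def stepLabel (a : PartitionCode n S) (j : Fin n) : SignedSet n ⊕ S → ℕ ×ₗ ℕ
  | .inl (_, false) => toLex (0, (j : ℕ) + 1)
  | .inl (i, true) => toLex (2, (i : ℕ) + 1)
  | .inr σ => toLex (1, signRank a.signs σ)

/-- The codes of a given type. -/
abbrev OfType (n : ℕ) {S : Type u} (σ₀ : S) (t : WeylFamily) : Type u :=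
  {a : PartitionCode n S // a.InFamily σ₀ t}

variable {σ₀ : S} {t : WeylFamily}

/-- The labels of the edges are those given by `stepLabel`. -/
def IsStepLabeling (lab : OfType n σ₀ t → OfType n σ₀ t → ℕ ×ₗ ℕ) : Prop :=
  ∀ a c : OfType n σ₀ t, ∀ j v, Step a.1 j v c.1 → lab a c = stepLabel a.1 j v

namespace IsStepLabeling

variable {lab : OfType n σ₀ t → OfType n σ₀ t → ℕ ×ₗ ℕ} {a b : OfType n σ₀ t}

theorem exists_coherent (hl : IsStepLabeling lab) (hab : a ≤ b) {i j : Fin n} (hi : a.1.IsRep i)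
    (hj : a.1.IsRep j) (hij : i < j) (h : b.1.val i = b.1.val j) :
    ∃ c, a ⋖ c ∧ c ≤ b ∧ lab a c = toLex (0, (j : ℕ) + 1) := by
  obtain ⟨c, hc, hcF⟩ := PartitionCode.exists_coherent a.2 hi hj hij
  exact ⟨⟨c, hcF⟩, covBy_iff.2 ⟨_, _, hc⟩, hc.le_iff.2 ⟨hab, by simpa using h⟩,
    hl a ⟨c, hcF⟩ _ _ hc⟩

theorem exists_coherent_of_ne (hl : IsStepLabeling lab) (hab : a ≤ b) {i j : Fin n}
    (hi : a.1.IsRep i) (hj : a.1.IsRep j) (hij : i ≠ j) (h : b.1.val i = b.1.val j) :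
    ∃ c, a ⋖ c ∧ c ≤ b ∧ ∃ m, lab a c = toLex (0, m) := by
  rcases hij.lt_or_gt with h' | h'
  · obtain ⟨c, h1, h2, h3⟩ := hl.exists_coherent hab hi hj h' h
    exact ⟨c, h1, h2, _, h3⟩
  · obtain ⟨c, h1, h2, h3⟩ := hl.exists_coherent hab hj hi h' h.symm
    exact ⟨c, h1, h2, _, h3⟩

theorem exists_noncoherent (hl : IsStepLabeling lab) (hab : a ≤ b) {i j : Fin n}
    (hi : a.1.IsRep i) (hj : a.1.IsRep j) (hij : i < j) (h : twist true (b.1.val i) = b.1.val j) :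
    ∃ c, a ⋖ c ∧ c ≤ b ∧ lab a c = toLex (2, (i : ℕ) + 1) := by
  obtain ⟨c, hc, hcF⟩ := PartitionCode.exists_noncoherent a.2 (b.2.ne_A_of_twist h) hi hj hij
  exact ⟨⟨c, hcF⟩, covBy_iff.2 ⟨_, _, hc⟩, hc.le_iff.2 ⟨hab, h⟩, hl a ⟨c, hcF⟩ _ _ hc⟩

theorem exists_sign (hl : IsStepLabeling lab) (hab : a ≤ b) {j : Fin n} (hj : a.1.IsRep j) {σ : S}
    (h : b.1.val j = .inr σ) (hσ : Restricted σ₀ t σ →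
      ∃ k, k ≠ j ∧ (a.1.val k = .inr σ ∨ ∃ e, a.1.val k = .inl (j, e))) :
    ∃ c, a ⋖ c ∧ c ≤ b ∧ lab a c = toLex (1, signRank a.1.signs σ) := by
  obtain ⟨c, hc, hcF⟩ := PartitionCode.exists_sign a.2 (b.2.ne_A_of_inr h) hj hσ
  exact ⟨⟨c, hcF⟩, covBy_iff.2 ⟨_, _, hc⟩, hc.le_iff.2 ⟨hab, h.symm⟩, hl a ⟨c, hcF⟩ _ _ hc⟩

theorem exists_sign_of_mem (hl : IsStepLabeling lab) (hab : a ≤ b) {j : Fin n} (hj : a.1.IsRep j)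
    {σ : S} (h : b.1.val j = .inr σ) (hσ : σ ∈ a.1.signs) :
    ∃ c, a ⋖ c ∧ c ≤ b ∧ lab a c = toLex (1, signRank a.1.signs σ) := by
  obtain ⟨c, hc, hcF⟩ := PartitionCode.exists_sign_of_mem a.2 hj hσ
  exact ⟨⟨c, hcF⟩, covBy_iff.2 ⟨_, _, hc⟩, hc.le_iff.2 ⟨hab, h.symm⟩, hl a ⟨c, hcF⟩ _ _ hc⟩

theorem exists_sign_of_unique (hl : IsStepLabeling lab) (hab : a ≤ b) {j : Fin n}
    (hj : a.1.IsRep j) {σ : S} (h : b.1.val j = .inr σ)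
    (huniq : ∀ k, a.1.IsRep k → b.1.val k = .inr σ → k = j) :
    ∃ c, a ⋖ c ∧ c ≤ b ∧ lab a c = toLex (1, signRank a.1.signs σ) := by
  obtain ⟨c, hc, hcF⟩ := PartitionCode.exists_sign_of_unique a.2 b.2 hab hj h huniq
  exact ⟨⟨c, hcF⟩, covBy_iff.2 ⟨_, _, hc⟩, hc.le_iff.2 ⟨hab, h.symm⟩, hl a ⟨c, hcF⟩ _ _ hc⟩

/-- After a sign step, the next sign may be adjoined whenever it could have been before. -/
theorem exists_sign_after (hl : IsStepLabeling lab) {z z' : OfType n σ₀ t} {j j' : Fin n}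
    {v : SignedSet n ⊕ S} {σ : S} (hz : Step a.1 j v z.1) (hz' : Step a.1 j' (.inr σ) z'.1)
    (hj : j' ≠ j) (hzb : z ≤ b) (hz'b : z' ≤ b) :
    ∃ c, z ⋖ c ∧ c ≤ b ∧ lab z c = toLex (1, signRank z.1.signs σ) := by
  have hb : b.1.val j' = .inr σ := (hz'.le_iff.1 hz'b).2.symm
  refine hl.exists_sign hzb (hz.isRep_iff.2 ⟨hz'.isRep, hj⟩) hb fun hr => ?_
  obtain ⟨k, hk, hk2⟩ := z'.2.2 σ j' hr hz'.val_self
  refine ⟨k, hk, ?_⟩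
  rcases hz'.val_inr_iff.1 hk2 with h1 | ⟨-, e, h1⟩
  · exact Or.inl (hz.val_eq_inr h1)
  · refine Or.inr ⟨e, ?_⟩
    rw [hz.val_eq, h1, subst, if_neg hj]

/-- Two representatives with equal values in b could be merged coherently, with a label (0, ·) below
the least one. -/
theorem eq_of_isMinAtom (hl : IsStepLabeling lab) {z : OfType n σ₀ t} (hab : a ≤ b)
    (hz : IsMinAtom lab a b z) {p q : ℕ} (h : lab a z = toLex (p, q)) (hp : p ≠ 0) {i j : Fin n}
    (hi : a.1.IsRep i) (hj : a.1.IsRep j) (hb : b.1.val i = b.1.val j) : i = j := by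
  by_contra hij
  obtain ⟨c, h1, h2, m, h3⟩ := hl.exists_coherent_of_ne hab hi hj hij hb
  have := hz.2.2 c h1 h2
  rw [h, h3, Prod.Lex.toLex_le_toLex] at this
  simp [hp] at this

theorem le_of_isMinAtom (hl : IsStepLabeling lab) {z : OfType n σ₀ t} (hab : a ≤ b)
    (hz : IsMinAtom lab a b z) {m : Fin n} (h : lab a z = toLex (0, (m : ℕ) + 1)) {i j : Fin n}
    (hi : a.1.IsRep i) (hj : a.1.IsRep j) (hij : i < j) (hb : b.1.val i = b.1.val j) : m ≤ j := by
  obtain ⟨c, h1, h2, h3⟩ := hl.exists_coherent hab hi hj hij hb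
  have := hz.2.2 c h1 h2
  rw [h, h3, Prod.Lex.toLex_le_toLex] at this
  simpa using this

variable [Finite S]

/-- Each condition is checked over the pairs of kinds of steps; many pairs are settled by the first
coordinates of the labels alone. -/
theorem goodInterval (hl : IsStepLabeling lab) (hab : a < b) : GoodInterval lab a b := by
  have hab' : a ≤ b := hab.le
  constructor
  · intro z z' hz haz' hz'b he
    obtain ⟨j, v, hs⟩ := covBy_iff.1 hz.1
    obtain ⟨j', v', hs'⟩ := covBy_iff.1 haz'
    have hv := (hs.le_iff.1 hz.2.1).2
    have hv' := (hs'.le_iff.1 hz'b).2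
    have hlz := hl a z _ _ hs
    rw [hl a z _ _ hs, hl a z' _ _ hs'] at he
    suffices j = j' ∧ v = v' by
      obtain ⟨rfl, rfl⟩ := this
      exact Subtype.ext (hs.unique hs')
    rcases v with ⟨i, _ | _⟩ | σ <;> rcases v' with ⟨i', _ | _⟩ | σ' <;>
      simp [stepLabel] at he hlz hv hv'
    · obtain rfl := Fin.ext he
      refine ⟨rfl, ?_⟩
      -- Distinct partners i, i' of j have equal values in b, so merging them would be an atom with
      -- label below (0, j + 1).
      rcases lt_trichotomy i i' with h | h | h
      · exact absurd (hl.le_of_isMinAtom hab' hz hlz (hs.adm rfl).2 (hs'.adm rfl).2 h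
          (hv.trans hv'.symm)) (hs'.adm rfl).1.not_ge
      · rw [h]
      · exact absurd (hl.le_of_isMinAtom hab' hz hlz (hs'.adm rfl).2 (hs.adm rfl).2 h
          (hv'.trans hv.symm)) (hs.adm rfl).1.not_ge
    · obtain rfl := Fin.ext he
      exact ⟨hl.eq_of_isMinAtom hab' hz hlz (by simp) hs.isRep hs'.isRep (hv.symm.trans hv'), rfl⟩
    · obtain rfl := signRank_injective _ he
      exact ⟨hl.eq_of_isMinAtom hab' hz hlz (by simp) hs.isRep hs'.isRep (hv.symm.trans hv'), rfl⟩
  · intro z w hz hzw hwb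
    obtain ⟨j, v, hs⟩ := covBy_iff.1 hz.1
    obtain ⟨j', v', hs'⟩ := covBy_iff.1 hzw
    have hv := (hs.le_iff.1 hz.2.1).2
    have hv' := (hs'.le_iff.1 hwb).2
    have hlz := hl a z _ _ hs
    have hrep : ∀ k, z.1.IsRep k → a.1.IsRep k ∧ k ≠ j := fun k => hs.isRep_iff.1
    obtain ⟨hj', hjj⟩ := hrep _ hs'.isRep
    rw [hl z w _ _ hs']
    rcases v with ⟨i, _ | _⟩ | σ <;> rcases v' with ⟨i', _ | _⟩ | σ' <;>
      simp [stepLabel] at hlz hv hv' ⊢ <;> rw [hlz, Prod.Lex.toLex_lt_toLex] <;>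
      simp
    · have := hl.le_of_isMinAtom hab' hz hlz (hrep _ (hs'.adm rfl).2).1 hj' (hs'.adm rfl).1 hv'
      exact lt_of_le_of_ne this hjj.symm
    · have := hl.eq_of_isMinAtom hab' hz hlz (by simp) (hrep _ (hs'.adm rfl).2).1 hj' hv'
      exact absurd this (hs'.adm rfl).1.ne
    · obtain ⟨c, h1, h2, h3⟩ := hl.exists_noncoherent hab' (hrep _ (hs'.adm rfl).2).1 hj'
        (hs'.adm rfl).1 hv'
      have h4 := hz.2.2 c h1 h2
      rw [hlz, h3, Prod.Lex.toLex_le_toLex] at h4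
      refine lt_of_le_of_ne (by simpa using h4) ?_
      rintro rfl
      exact hjj (hl.eq_of_isMinAtom hab' hz hlz (by simp) hj' hs.isRep (hv'.symm.trans hv))
    · obtain ⟨c, h1, h2, h3⟩ := hl.exists_sign_of_unique hab' hj' hv'.symm fun k hk hk2 =>
        hl.eq_of_isMinAtom hab' hz hlz (by simp) hk hj' (hk2.trans hv')
      have h4 := hz.2.2 c h1 h2
      rw [hlz, h3, Prod.Lex.toLex_le_toLex] at h4
      simp at h4
    · have := hl.eq_of_isMinAtom hab' hz hlz (by simp) (hrep _ (hs'.adm rfl).2).1 hj' hv'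
      exact absurd this (hs'.adm rfl).1.ne
    · have hne : σ ≠ σ' := by
        rintro rfl
        exact hjj (hl.eq_of_isMinAtom hab' hz hlz (by simp) hj' hs.isRep (hv'.symm.trans hv))
      obtain ⟨c, h1, h2, h3⟩ := hl.exists_sign_of_unique hab' hj' hv'.symm fun k hk hk2 =>
        hl.eq_of_isMinAtom hab' hz hlz (by simp) hk hj' (hk2.trans hv')
      have h4 := hz.2.2 c h1 h2
      rw [hlz, h3, Prod.Lex.toLex_le_toLex] at h4
      have h5 : signRank a.1.signs σ ≤ signRank a.1.signs σ' := by simpa using h4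
      rw [hs.signs_inr]
      -- Adjoining σ does not lower the rank of σ'.
      exact (h5.lt_of_ne ((signRank_injective _).ne hne)).trans_le (signRank_le_insert hne)
  · intro z z' haz hzb haz' hz'b hlt
    obtain ⟨j, v, hs⟩ := covBy_iff.1 haz
    obtain ⟨j', v', hs'⟩ := covBy_iff.1 haz'
    have hv := (hs.le_iff.1 hzb).2
    have hv' := (hs'.le_iff.1 hz'b).2
    have hrep : ∀ k, a.1.IsRep k → k ≠ j → z.1.IsRep k := fun k h1 h2 => hs.isRep_iff.2 ⟨h1, h2⟩
    have hvalz : z.1.val j = v := hs.val_self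
    rw [hl a z _ _ hs, hl a z' _ _ hs'] at hlt
    rw [hl a z _ _ hs]
    rcases v with ⟨i, _ | _⟩ | σ
    · rcases v' with ⟨i', _ | _⟩ | σ' <;>
        simp [stepLabel, Prod.Lex.toLex_lt_toLex] at hlt hv hv'
      have hi' : i' ≠ j := ((hs'.adm rfl).1.trans hlt).ne
      obtain ⟨w, h1, h2, h3⟩ := hl.exists_coherent hzb (hrep _ (hs'.adm rfl).2 hi')
        (hrep _ hs'.isRep hlt.ne) (hs'.adm rfl).1 hv'
      refine ⟨w, h1, h2, ?_⟩
      rw [h3, stepLabel, Prod.Lex.toLex_le_toLex]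
      simpa using hlt.le
    · have hi := (hs.adm rfl).2
      have hij := (hs.adm rfl).1
      have hzi := hrep i hi hij.ne
      simp only [ext'_inl] at hv
      -- a coherent pair, a noncoherent pair with small label, or a sign step at `z`
      have done_coh : ∀ p q : Fin n, z.1.IsRep p → z.1.IsRep q → p ≠ q →
          b.1.val p = b.1.val q →
          ∃ w, z ⋖ w ∧ w ≤ b ∧ lab z w ≤ stepLabel a.1 j (.inl (i, true)) := by
        intro p q hp hq hpq h
        obtain ⟨w, h1, h2, m, h3⟩ := hl.exists_coherent_of_ne hzb hp hq hpq h
        exact ⟨w, h1, h2, by rw [h3, stepLabel, Prod.Lex.toLex_le_toLex]; simp⟩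
      have done_sign : ∀ σ : S, b.1.val j = .inr σ →
          ∃ w, z ⋖ w ∧ w ≤ b ∧ lab z w ≤ stepLabel a.1 j (.inl (i, true)) := by
        intro σ hσ
        -- In z the block of i also contains the bar of j, so the size restriction is harmless.
        obtain ⟨w, h1, h2, h3⟩ := hl.exists_sign hzb hzi (σ := σ)
          (by rwa [hσ, twist_eq_inr] at hv) fun _ => ⟨j, hij.ne', Or.inr ⟨true, hvalz⟩⟩
        exact ⟨w, h1, h2, by rw [h3, stepLabel, Prod.Lex.toLex_le_toLex]; simp⟩
      -- If b identifies k with j, it identifies k with the bar of i, and the label of that merge is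
      -- at most (2, i + 1). For k = i the value is its own bar, hence a sign.
      have done_pair : ∀ k, a.1.IsRep k → k ≠ j → b.1.val k = b.1.val j →
          ∃ w, z ⋖ w ∧ w ≤ b ∧ lab z w ≤ stepLabel a.1 j (.inl (i, true)) := by
        intro k hk hkj hbk
        rcases lt_trichotomy k i with h | h | h
        · obtain ⟨w, h1, h2, h3⟩ := hl.exists_noncoherent hzb (hrep k hk hkj) hzi h
            (by rw [hbk, ← hv, twist_self])
          refine ⟨w, h1, h2, ?_⟩
          rw [h3, stepLabel, Prod.Lex.toLex_le_toLex]
          simpa using h.le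
        · subst h
          obtain ⟨σ, hσ⟩ := eq_inr_of_twist_true_eq (hv.trans hbk.symm)
          exact done_sign σ (hbk ▸ hσ)
        · obtain ⟨w, h1, h2, h3⟩ := hl.exists_noncoherent hzb hzi (hrep k hk hkj) h
            (by rw [hbk, hv])
          refine ⟨w, h1, h2, ?_⟩
          rw [h3, stepLabel]
      rcases v' with ⟨i', _ | _⟩ | σ'
      · simp only [ext'_inl, twist_false] at hv'
        have hne := (hs'.adm rfl).1.ne
        by_cases h1 : i' = j
        · subst h1
          exact done_pair j' hs'.isRep hne.symm hv'.symm
        · by_cases h2 : j' = j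
          · subst h2
            exact done_pair i' (hs'.adm rfl).2 hne hv'
          · exact done_coh i' j' (hrep _ (hs'.adm rfl).2 h1) (hrep _ hs'.isRep h2) hne hv'
      · simp [stepLabel, Prod.Lex.toLex_lt_toLex] at hlt
        simp only [ext'_inl] at hv'
        have hzi' := hrep i' (hs'.adm rfl).2 (hlt.trans hij).ne
        by_cases h2 : j' = j
        · subst h2
          exact done_coh i' i hzi' hzi hlt.ne (twist_injective true (hv'.trans hv.symm))
        · obtain ⟨w, h3, h4, h5⟩ := hl.exists_noncoherent hzb hzi' (hrep _ hs'.isRep h2)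
            (hs'.adm rfl).1 hv'
          refine ⟨w, h3, h4, ?_⟩
          rw [h5, stepLabel, Prod.Lex.toLex_le_toLex]
          simpa using hlt.le
      · by_cases h2 : j' = j
        · subst h2
          exact done_sign σ' hv'.symm
        · obtain ⟨w, h3, h4, h5⟩ := hl.exists_sign_after hs hs' h2 hzb hz'b
          exact ⟨w, h3, h4, by rw [h5, stepLabel, Prod.Lex.toLex_le_toLex]; simp⟩
    · simp only [ext'_inr] at hv
      -- A block that b identifies with that of j must join the σ-block, whose sign is now in use.
      have done_sign : ∀ k, a.1.IsRep k → k ≠ j → b.1.val k = b.1.val j →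
          ∃ w, z ⋖ w ∧ w ≤ b ∧ lab z w ≤ stepLabel a.1 j (.inr σ) := by
        intro k hk hkj hbk
        obtain ⟨w, h1, h2, h3⟩ := hl.exists_sign_of_mem hzb (hrep k hk hkj)
          (hbk.trans hv.symm) ⟨j, hvalz⟩
        refine ⟨w, h1, h2, ?_⟩
        rw [h3, stepLabel, Prod.Lex.toLex_le_toLex, hs.signs_inr]
        simpa using signRank_insert_self_le _ _
      rcases v' with ⟨i', _ | _⟩ | σ'
      · simp only [ext'_inl, twist_false] at hv'
        have hne := (hs'.adm rfl).1.ne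
        by_cases h1 : i' = j
        · subst h1
          exact done_sign j' hs'.isRep hne.symm hv'.symm
        · by_cases h2 : j' = j
          · subst h2
            exact done_sign i' (hs'.adm rfl).2 hne hv'
          · obtain ⟨w, h3, h4, m, h5⟩ := hl.exists_coherent_of_ne hzb
              (hrep _ (hs'.adm rfl).2 h1) (hrep _ hs'.isRep h2) hne hv'
            exact ⟨w, h3, h4, by rw [h5, stepLabel, Prod.Lex.toLex_le_toLex]; simp⟩
      · simp [stepLabel, Prod.Lex.toLex_lt_toLex] at hlt
      · simp [stepLabel, Prod.Lex.toLex_lt_toLex] at hlt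
        simp only [ext'_inr] at hv'
        have hne : σ ≠ σ' := by
          rintro rfl
          exact lt_irrefl _ hlt
        have hjj : j' ≠ j := by
          rintro rfl
          exact hne (by simpa using hv.trans hv'.symm)
        obtain ⟨w, h3, h4, h5⟩ := hl.exists_sign_after hs hs' hjj hzb hz'b
        refine ⟨w, h3, h4, ?_⟩
        rw [h5, stepLabel, Prod.Lex.toLex_le_toLex, hs.signs_inr]
        -- Adjoining σ raises the rank of σ' by at most one, which the strict inequality absorbs.
        simpa using (signRank_insert_le_succ hne).trans hlt

end IsStepLabeling

end PartitionCode

/-! ### Intervals that end in the added greatest element -/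

namespace PartitionCode

namespace IsStepLabeling

variable {n : ℕ} {S : Type u} [LinearOrder S] {σ₀ : S} {t : WeylFamily}
variable {lab : OfType n σ₀ t → OfType n σ₀ t → ℕ ×ₗ ℕ} {a b : OfType n σ₀ t}

/-- If signs are in use, the least of them has rank 1. Otherwise every index belongs to j, and the
least sign of all can be used unless n = 1 makes the block too small. -/
theorem exists_label_eq_one [Finite S] (hl : IsStepLabeling lab)
    (hB : t = .B → n = 1 → ∀ σ, σ₀ ≤ σ) {z : OfType n σ₀ t} {j : Fin n} {σ : S}
    (hs : Step a.1 j (.inr σ) z.1) (huniq : ∀ k, a.1.IsRep k → k = j) :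
    ∃ c, a ⋖ c ∧ lab a c = toLex (1, 1) := by
  suffices ∃ τ c, Step a.1 j (.inr τ) c ∧ c.InFamily σ₀ t ∧ signRank a.1.signs τ = 1 by
    obtain ⟨τ, c, hc, hcF, h1⟩ := this
    exact ⟨⟨c, hcF⟩, covBy_iff.2 ⟨_, _, hc⟩, by rw [hl a ⟨c, hcF⟩ _ _ hc, stepLabel, h1]⟩
  rcases a.1.signs.eq_empty_or_nonempty with hempty | hne
  · have hA := z.2.ne_A_of_inr hs.val_self
    have hval : ∀ k, ∃ e, a.1.val k = .inl (j, e) := by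
      intro k
      rcases hk : a.1.val k with ⟨r, e⟩ | ρ
      · exact ⟨e, by rw [huniq r (isRep_of_val hk)]⟩
      · exact absurd (show ρ ∈ a.1.signs from ⟨k, hk⟩) (by simp [hempty])
    by_cases hk : ∃ k, k ≠ j
    · obtain ⟨k, hk⟩ := hk
      obtain ⟨τ, -, hτ⟩ := Set.exists_min_image Set.univ (id : S → S) (Set.toFinite _) ⟨σ₀, trivial⟩
      obtain ⟨c, hc, hcF⟩ := PartitionCode.exists_sign a.2 hA hs.isRep (σ := τ)
        fun _ => ⟨k, hk, Or.inr (hval k)⟩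
      exact ⟨τ, c, hc, hcF, by
        rw [hempty]; exact signRank_empty_of_forall_le fun ρ => hτ ρ trivial⟩
    -- For n = 1 every sign block has two elements: type D has no sign step, and type B allows only
    -- σ₀, which is least by `hB`.
    · push Not at hk
      have hn : n = 1 := by
        simpa using Fintype.card_eq_one_iff.2 ⟨j, hk⟩
      have hD : ¬ Restricted σ₀ t σ := fun hr => by
        obtain ⟨k, hkj, -⟩ := z.2.2 σ j hr hs.val_self
        exact hkj (hk k)
      obtain ⟨τ, hτ, hτr⟩ : ∃ τ : S, (∀ ρ, τ ≤ ρ) ∧ ¬ Restricted σ₀ t τ := by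
        cases t with
        | A => exact absurd rfl hA
        | B => exact ⟨σ₀, hB rfl hn, fun h => h rfl⟩
        | C =>
          obtain ⟨τ, -, hτ⟩ := Set.exists_min_image Set.univ (id : S → S) (Set.toFinite _)
            ⟨σ₀, trivial⟩
          exact ⟨τ, fun ρ => hτ ρ trivial, id⟩
        | D => exact absurd trivial hD
      obtain ⟨c, hc, hcF⟩ := PartitionCode.exists_sign a.2 hA hs.isRep (σ := τ)
        fun h => absurd h hτr
      exact ⟨τ, c, hc, hcF, by rw [hempty]; exact signRank_empty_of_forall_le hτ⟩
  · obtain ⟨τ, hτ, h1⟩ := exists_signRank_eq_one hne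
    obtain ⟨c, hc, hcF⟩ := PartitionCode.exists_sign_of_mem a.2 hs.isRep hτ
    exact ⟨τ, c, hc, hcF, h1⟩

variable {labTop : WithTop (OfType n σ₀ t) → WithTop (OfType n σ₀ t) → ℕ ×ₗ ℕ}

/-- Below ⊤ every step is available, so a least atom that is not coherent leaves only one
representative in a. -/
theorem goodInterval_top [Finite S] (hl : IsStepLabeling lab)
    (hB : t = .B → n = 1 → ∀ σ, σ₀ ≤ σ)
    (hcoe : ∀ x y : OfType n σ₀ t, labTop x y = lab x y)
    (htop : ∀ x : OfType n σ₀ t, labTop x ⊤ = toLex (1, 2)) :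
    GoodInterval labTop (a : WithTop (OfType n σ₀ t)) ⊤ := by
  have hmax : ∀ {z : OfType n σ₀ t}, a ⋖ z → ¬ (a : WithTop (OfType n σ₀ t)) ⋖ ⊤ :=
    fun {z} h h' => (WithTop.coe_covBy_top.1 h').not_lt h.lt
  have hcoh : ∀ {c : OfType n σ₀ t} {i j : Fin n}, c.1.IsRep i → c.1.IsRep j → i < j →
      ∃ d, c ⋖ d ∧ lab c d = toLex (0, (j : ℕ) + 1) := by
    intro c i j hi hj hij
    obtain ⟨d, hd, hdF⟩ := PartitionCode.exists_coherent c.2 hi hj hij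
    exact ⟨⟨d, hdF⟩, covBy_iff.2 ⟨_, _, hd⟩, hl c ⟨d, hdF⟩ _ _ hd⟩
  have hcoh' : ∀ {c : OfType n σ₀ t} {i j : Fin n}, c.1.IsRep i → c.1.IsRep j → i ≠ j →
      ∃ d, c ⋖ d ∧ ∃ m, lab c d = toLex (0, m) := by
    intro c i j hi hj hij
    rcases hij.lt_or_gt with h | h
    · obtain ⟨d, h1, h2⟩ := hcoh hi hj h
      exact ⟨d, h1, _, h2⟩
    · obtain ⟨d, h1, h2⟩ := hcoh hj hi h
      exact ⟨d, h1, _, h2⟩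
  have hmin : ∀ {z c : OfType n σ₀ t}, IsMinAtom labTop (a : WithTop (OfType n σ₀ t)) ⊤ z →
      a ⋖ c → lab a z ≤ lab a c := by
    intro z c hz hc
    simpa [hcoe] using hz.2.2 c (WithTop.coe_covBy_coe.2 hc) le_top
  have heq : ∀ {z : OfType n σ₀ t} {p q : ℕ}, IsMinAtom labTop (a : WithTop (OfType n σ₀ t)) ⊤ z →
      lab a z = toLex (p, q) → p ≠ 0 → ∀ {i j : Fin n}, a.1.IsRep i → a.1.IsRep j → i = j := by
    intro z p q hz h hp i j hi hj
    by_contra hij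
    obtain ⟨d, h1, m, h2⟩ := hcoh' hi hj hij
    have := hmin hz h1
    rw [h, h2, Prod.Lex.toLex_le_toLex] at this
    simp [hp] at this
  have hle : ∀ {z : OfType n σ₀ t} {m : Fin n},
      IsMinAtom labTop (a : WithTop (OfType n σ₀ t)) ⊤ z →
      lab a z = toLex (0, (m : ℕ) + 1) → ∀ {i j : Fin n}, a.1.IsRep i → a.1.IsRep j → i < j →
      m ≤ j := by
    intro z m hz h i j hi hj hij
    obtain ⟨d, h1, h2⟩ := hcoh hi hj hij
    have := hmin hz h1
    rw [h, h2, Prod.Lex.toLex_le_toLex] at this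
    simpa using this
  constructor
  · intro z z' hz haz' _ he
    cases z with
    | top =>
      cases z' with
      | top => rfl
      | coe z' => exact absurd hz.1 (hmax (WithTop.coe_covBy_coe.1 haz'))
    | coe z =>
    have haz := WithTop.coe_covBy_coe.1 hz.1
    cases z' with
    | top => exact absurd haz' (hmax haz)
    | coe z' =>
    obtain ⟨j, v, hs⟩ := covBy_iff.1 haz
    obtain ⟨j', v', hs'⟩ := covBy_iff.1 (WithTop.coe_covBy_coe.1 haz')
    have hlz := hl a z _ _ hs
    rw [hcoe, hcoe, hl a z _ _ hs, hl a z' _ _ hs'] at he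
    suffices j = j' ∧ v = v' by
      obtain ⟨rfl, rfl⟩ := this
      rw [Subtype.ext (hs.unique hs')]
    rcases v with ⟨i, _ | _⟩ | σ <;> rcases v' with ⟨i', _ | _⟩ | σ' <;>
      simp [stepLabel] at he hlz
    · obtain rfl := Fin.ext he
      refine ⟨rfl, ?_⟩
      rcases lt_trichotomy i i' with h | h | h
      · exact absurd (hle hz hlz (hs.adm rfl).2 (hs'.adm rfl).2 h) (hs'.adm rfl).1.not_ge
      · rw [h]
      · exact absurd (hle hz hlz (hs'.adm rfl).2 (hs.adm rfl).2 h) (hs.adm rfl).1.not_ge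
    · obtain rfl := Fin.ext he
      exact ⟨heq hz hlz (by simp) hs.isRep hs'.isRep, rfl⟩
    · obtain rfl := signRank_injective _ he
      exact ⟨heq hz hlz (by simp) hs.isRep hs'.isRep, rfl⟩
  · intro z w hz hzw _
    cases z with
    | top => exact absurd hzw.lt not_top_lt
    | coe z =>
    have haz := WithTop.coe_covBy_coe.1 hz.1
    obtain ⟨j, v, hs⟩ := covBy_iff.1 haz
    have hlz := hl a z _ _ hs
    -- A noncoherent step involves two representatives, and these could be merged coherently with a
    -- smaller label.
    have hnon : ∀ i : Fin n, v ≠ .inl (i, true) := by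
      rintro i rfl
      exact absurd (heq hz hlz (by simp) (hs.adm rfl).2 hs.isRep) (hs.adm rfl).1.ne
    cases w with
    | top =>
      rw [hcoe, htop, hlz]
      rcases v with ⟨i, _ | _⟩ | σ
      · rw [stepLabel, Prod.Lex.toLex_lt_toLex]
        simp
      · exact absurd rfl (hnon i)
      · obtain ⟨c, h1, h2⟩ := hl.exists_label_eq_one hB hs
          fun k hk => heq hz hlz (by simp) hk hs.isRep
        have h3 := hmin hz h1
        rw [hlz, h2] at h3
        refine h3.trans_lt ?_
        rw [Prod.Lex.toLex_lt_toLex]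
        simp
    | coe w =>
    obtain ⟨j', v', hs'⟩ := covBy_iff.1 (WithTop.coe_covBy_coe.1 hzw)
    obtain ⟨hj', hjj⟩ := hs.isRep_iff.1 hs'.isRep
    rw [hcoe, hcoe, hlz, hl z w _ _ hs']
    rcases v with ⟨i, _ | _⟩ | σ
    · rcases v' with ⟨i', _ | _⟩ | σ' <;> rw [stepLabel, stepLabel, Prod.Lex.toLex_lt_toLex] <;>
        simp
      exact lt_of_le_of_ne
        (hle hz hlz (hs.isRep_iff.1 (hs'.adm rfl).2).1 hj' (hs'.adm rfl).1) hjj.symm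
    · exact absurd rfl (hnon i)
    · exact absurd (heq hz hlz (by simp) hj' hs.isRep) hjj
  · intro z z' haz _ haz' _ hlt
    cases z with
    | top =>
      cases z' with
      | top => exact absurd hlt (lt_irrefl _)
      | coe z' => exact absurd haz (hmax (WithTop.coe_covBy_coe.1 haz'))
    | coe z =>
    rw [WithTop.coe_covBy_coe] at haz
    cases z' with
    | top => exact absurd haz' (hmax haz)
    | coe z' =>
    rw [WithTop.coe_covBy_coe] at haz'
    obtain ⟨j, v, hs⟩ := covBy_iff.1 haz
    obtain ⟨j', v', hs'⟩ := covBy_iff.1 haz'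
    have hrep : ∀ k, a.1.IsRep k → k ≠ j → z.1.IsRep k := fun k h1 h2 => hs.isRep_iff.2 ⟨h1, h2⟩
    rw [hcoe, hcoe, hl a z _ _ hs, hl a z' _ _ hs'] at hlt
    rw [hcoe, hl a z _ _ hs]
    suffices (∃ w, z ⋖ w ∧ lab z w ≤ stepLabel a.1 j v) ∨
        (IsMax z ∧ toLex (1, 2) ≤ stepLabel a.1 j v) by
      rcases this with ⟨w, h1, h2⟩ | ⟨h1, h2⟩
      · exact ⟨w, WithTop.coe_covBy_coe.2 h1, le_top, by rwa [hcoe]⟩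
      · exact ⟨⊤, WithTop.coe_covBy_top.2 h1, le_rfl, by rwa [htop]⟩
    rcases v with ⟨i, _ | _⟩ | σ
    · left
      rcases v' with ⟨i', _ | _⟩ | σ' <;> simp [stepLabel, Prod.Lex.toLex_lt_toLex] at hlt
      obtain ⟨w, h1, h2⟩ := hcoh (hrep _ (hs'.adm rfl).2 ((hs'.adm rfl).1.trans hlt).ne)
        (hrep _ hs'.isRep hlt.ne) (hs'.adm rfl).1
      refine ⟨w, h1, ?_⟩
      rw [h2, stepLabel, Prod.Lex.toLex_le_toLex]
      simpa using hlt.le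
    · left
      have hij := (hs.adm rfl).1
      have hzi := hrep i (hs.adm rfl).2 hij.ne
      -- Any sign would do, since the block of i also contains the bar of j; σ₀ merely shows that a
      -- sign exists.
      obtain ⟨c, hc, hcF⟩ := PartitionCode.exists_sign z.2 (z.2.ne_A_of_inl hs.val_self) hzi
        (σ := σ₀) fun _ => ⟨j, hij.ne', Or.inr ⟨true, hs.val_self⟩⟩
      refine ⟨⟨c, hcF⟩, covBy_iff.2 ⟨_, _, hc⟩, ?_⟩
      rw [hl z ⟨c, hcF⟩ _ _ hc, stepLabel, stepLabel, Prod.Lex.toLex_le_toLex]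
      simp
    · by_cases hk : ∃ k, a.1.IsRep k ∧ k ≠ j
      · left
        obtain ⟨k, hk, hkj⟩ := hk
        obtain ⟨c, hc, hcF⟩ := PartitionCode.exists_sign_of_mem z.2 (hrep k hk hkj)
          (σ := σ) ⟨j, hs.val_self⟩
        refine ⟨⟨c, hcF⟩, covBy_iff.2 ⟨_, _, hc⟩, ?_⟩
        rw [hl z ⟨c, hcF⟩ _ _ hc, stepLabel, stepLabel, Prod.Lex.toLex_le_toLex, hs.signs_inr]
        simpa using signRank_insert_self_le _ _
      · right
        push Not at hk
        constructor
        · rw [isMax_iff_forall_not_lt]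
          intro w hw
          obtain ⟨k, hk2, -⟩ := exists_isRep_of_lt (show z.1 < w.1 from hw)
          exact (hs.isRep_iff.1 hk2).2 (hk k (hs.isRep_iff.1 hk2).1)
        -- The only smaller competitor is another sign step, of rank at least 1, so the rank of σ is
        -- at least 2.
        · rcases v' with ⟨i', _ | _⟩ | σ'
          · exact absurd ((hk _ (hs'.adm rfl).2).trans (hk _ hs'.isRep).symm) (hs'.adm rfl).1.ne
          · simp [stepLabel, Prod.Lex.toLex_lt_toLex] at hlt
          · simp [stepLabel, Prod.Lex.toLex_lt_toLex] at hlt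
            rw [stepLabel, Prod.Lex.toLex_le_toLex]
            have := signRank_pos a.1.signs σ'
            simp
            omega

end IsStepLabeling

end PartitionCode

/-! ### From codes to labeled partitions -/

theorem mem_bar {n : ℕ} {X : Finset (SignedSet n)} {p : SignedSet n} :
    p ∈ bar X ↔ (p.1, !p.2) ∈ X := by
  simp only [bar, Finset.mem_image]
  constructor
  · rintro ⟨q, hq, rfl⟩
    simpa using hq
  · intro h
    exact ⟨_, h, by simp⟩

namespace PartitionCode

variable {n : ℕ} {S : Type u}

open Classical in
/-- The elements of `[[n]]` of value `v`; the nonempty sets of this form are the blocks of the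
labeled partition encoded by `a`. -/
noncomputable def fiber (a : PartitionCode n S) (v : SignedSet n ⊕ S) : Finset (SignedSet n) :=
  Finset.univ.filter fun p => a.ext' (.inl p) = v

@[simp] theorem mem_fiber {a : PartitionCode n S} {v : SignedSet n ⊕ S} {p : SignedSet n} :
    p ∈ a.fiber v ↔ a.ext' (.inl p) = v := by
  simp [fiber]

theorem ext'_bar (a : PartitionCode n S) (p : SignedSet n) :
    a.ext' (.inl (p.1, !p.2)) = twist true (a.ext' (.inl p)) := by
  obtain ⟨i, e⟩ := p
  rw [← ext'_twist]
  simp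

theorem bar_fiber (a : PartitionCode n S) (v : SignedSet n ⊕ S) :
    bar (a.fiber v) = a.fiber (twist true v) := by
  ext p
  rw [mem_bar, mem_fiber, mem_fiber, ext'_bar]
  constructor
  · rintro rfl
    simp
  · intro h
    rw [h, twist_self]

open Classical in
/-- The partition of `[[n]]` encoded by `a`. -/
noncomputable def toFinpartition (a : PartitionCode n S) :
    Finpartition (Finset.univ : Finset (SignedSet n)) :=
  Finpartition.ofExistsUnique (Finset.univ.image fun p => a.fiber (a.ext' (.inl p)))
    (fun _ _ => Finset.subset_univ _)
    (fun p _ => ⟨a.fiber (a.ext' (.inl p)), ⟨Finset.mem_image_of_mem _ (Finset.mem_univ _),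
      mem_fiber.2 rfl⟩, by
        rintro R ⟨hR, hp⟩
        obtain ⟨q, -, rfl⟩ := Finset.mem_image.1 hR
        rw [mem_fiber.1 hp]⟩)
    (fun h => by
      obtain ⟨q, -, hq⟩ := Finset.mem_image.1 h
      have : q ∈ a.fiber (a.ext' (.inl q)) := mem_fiber.2 rfl
      simp [hq] at this)

theorem mem_toFinpartition {a : PartitionCode n S} {R : Finset (SignedSet n)} :
    R ∈ a.toFinpartition.parts ↔ ∃ p, R = a.fiber (a.ext' (.inl p)) := by
  simp [toFinpartition, Finpartition.ofExistsUnique, eq_comm]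

/-- The labeled partition encoded by `a`. -/
noncomputable def toLabeledPartition (a : PartitionCode n S) : LabeledPartition n S where
  blocks := a.toFinpartition
  signedBlock σ := a.fiber (.inr σ)
  signedBlock_mem σ := by
    rintro ⟨p, hp⟩
    exact mem_toFinpartition.2 ⟨p, by rw [mem_fiber.1 hp]⟩
  signedBlock_inj σ τ := by
    rintro ⟨p, hp⟩ h
    have hp' := h ▸ hp
    simpa using (mem_fiber.1 hp).symm.trans (mem_fiber.1 hp')
  bar_mem R hR := by
    obtain ⟨p, rfl⟩ := mem_toFinpartition.1 hR
    exact mem_toFinpartition.2 ⟨(p.1, !p.2), by rw [bar_fiber, ext'_bar]⟩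
  bar_eq_iff R hR := by
    obtain ⟨p, rfl⟩ := mem_toFinpartition.1 hR
    rw [bar_fiber]
    have hp : p ∈ a.fiber (a.ext' (.inl p)) := mem_fiber.2 rfl
    constructor
    · intro h
      rw [← h] at hp
      obtain ⟨σ, hσ⟩ := eq_inr_of_twist_true_eq (mem_fiber.1 hp).symm
      exact ⟨σ, by rw [hσ]⟩
    · rintro ⟨σ, hσ⟩
      rw [← hσ] at hp
      rw [mem_fiber.1 hp, twist_inr]

theorem mem_blocks_toLabeledPartition {a : PartitionCode n S} {R : Finset (SignedSet n)} :
    R ∈ a.toLabeledPartition.blocks.parts ↔ ∃ p, R = a.fiber (a.ext' (.inl p)) :=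
  mem_toFinpartition

@[simp] theorem signedBlock_toLabeledPartition (a : PartitionCode n S) (σ : S) :
    a.toLabeledPartition.signedBlock σ = a.fiber (.inr σ) := rfl

/-- An index and its value in a lie in the same block, so refinement says precisely that b does not
distinguish them. -/
theorem toLabeledPartition_le_iff {a b : PartitionCode n S} :
    a.toLabeledPartition ≤ b.toLabeledPartition ↔ a ≤ b := by
  constructor
  · rintro ⟨h1, h2⟩ i
    rcases hi : a.val i with ⟨r, e⟩ | σ
    · obtain ⟨T, hT, hRT⟩ := h2 _ (mem_blocks_toLabeledPartition.2 ⟨(i, false), rfl⟩)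
      obtain ⟨q, rfl⟩ := mem_blocks_toLabeledPartition.1 hT
      have h3 : ((i, false) : SignedSet n) ∈ _ := hRT (mem_fiber.2 rfl)
      have h4 : ((r, e) : SignedSet n) ∈ _ := hRT (mem_fiber.2 (by simp [hi, a.val_of_val hi]))
      rw [(mem_fiber.1 h4).trans (mem_fiber.1 h3).symm]
      simp
    · have h3 : ((i, false) : SignedSet n) ∈ b.fiber (.inr σ) :=
        h1 σ (mem_fiber.2 (by simp [hi]))
      simpa using (mem_fiber.1 h3).symm
  · intro h
    constructor
    · intro σ p hp
      rw [signedBlock_toLabeledPartition, mem_fiber] at hp ⊢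
      rw [← ext'_ext'_of_le h, hp, ext'_inr]
    · intro R hR
      obtain ⟨p, rfl⟩ := mem_blocks_toLabeledPartition.1 hR
      refine ⟨_, mem_blocks_toLabeledPartition.2 ⟨p, rfl⟩, fun q hq => ?_⟩
      rw [mem_fiber] at hq ⊢
      rw [← ext'_ext'_of_le h, hq, ext'_ext'_of_le h]

/-- `v` is the value of `p` in the code of the labeled partition `x`. -/
def IsValue (x : LabeledPartition n S) (p : SignedSet n) : SignedSet n ⊕ S → Prop
  | .inl q => (∀ σ, p ∉ x.signedBlock σ) ∧ q ∈ x.blocks.part p ∧ ∀ s ∈ x.blocks.part p, q.1 ≤ s.1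
  | .inr σ => p ∈ x.signedBlock σ

section IsValue

variable {x : LabeledPartition n S} {p q : SignedSet n} {v w : SignedSet n ⊕ S}

theorem part_eq_of_mem_part (h : q ∈ x.blocks.part p) : x.blocks.part q = x.blocks.part p :=
  x.blocks.part_eq_of_mem (x.blocks.part_mem.2 (Finset.mem_univ _)) h

theorem part_eq_signedBlock {σ : S} (h : p ∈ x.signedBlock σ) :
    x.blocks.part p = x.signedBlock σ :=
  x.blocks.part_eq_of_mem (x.signedBlock_mem σ ⟨p, h⟩) h

theorem bar_part : bar (x.blocks.part p) = x.blocks.part (p.1, !p.2) := by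
  refine (x.blocks.part_eq_of_mem
    (x.bar_mem _ (x.blocks.part_mem.2 (Finset.mem_univ _))) ?_).symm
  simp [mem_bar]

theorem bar_signedBlock (σ : S) : bar (x.signedBlock σ) = x.signedBlock σ := by
  rcases (x.signedBlock σ).eq_empty_or_nonempty with h | h
  · rw [h]; rfl
  · exact (x.bar_eq_iff _ (x.signedBlock_mem σ h)).2 ⟨σ, rfl⟩

theorem isValue_iff_of_mem_part (h : q ∈ x.blocks.part p) : IsValue x q v ↔ IsValue x p v := by
  have h1 := part_eq_of_mem_part h
  have h2 : ∀ σ, q ∈ x.signedBlock σ ↔ p ∈ x.signedBlock σ := by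
    intro σ
    constructor
    · intro hq
      rw [← part_eq_signedBlock hq, h1]
      exact x.blocks.mem_part (Finset.mem_univ _)
    · intro hp
      rwa [← part_eq_signedBlock hp]
  rcases v with r | σ
  · simp [IsValue, h1, h2]
  · exact h2 σ

theorem isValue_bar (h : IsValue x p v) : IsValue x (p.1, !p.2) (twist true v) := by
  have h2 : ∀ σ, (p.1, !p.2) ∈ x.signedBlock σ ↔ p ∈ x.signedBlock σ := by
    intro σ
    rw [← mem_bar, bar_signedBlock]
  rcases v with ⟨r, e⟩ | σ
  · obtain ⟨h3, h4, h5⟩ := h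
    refine ⟨fun σ => by rw [h2]; exact h3 σ, ?_, fun s hs => ?_⟩
    · rw [← bar_part, mem_bar]
      simpa using h4
    · rw [← bar_part, mem_bar] at hs
      exact h5 (s.1, !s.2) hs
  · exact (h2 σ).2 h

theorem isValue_twist (e : Bool) (h : IsValue x (p.1, false) v) :
    IsValue x (p.1, e) (twist e v) := by
  cases e
  · simpa using h
  · exact isValue_bar h

/-- If the least index occurred both with and without a bar, the block would equal its bar and hence
be signed. -/
theorem IsValue.unique (h : IsValue x p v) (h' : IsValue x p w) : v = w := by
  rcases v with ⟨r, e⟩ | σ <;> rcases w with ⟨s, f⟩ | τ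
  · obtain ⟨h1, h2, h3⟩ := h
    obtain ⟨-, h2', h3'⟩ := h'
    obtain rfl : r = s := le_antisymm (h3 _ h2') (h3' _ h2)
    by_contra hne
    have hef : f = !e := by
      cases e <;> cases f <;> simp_all
    subst hef
    have h4 : bar (x.blocks.part p) = x.blocks.part p := by
      rw [← part_eq_of_mem_part h2, bar_part]
      exact (part_eq_of_mem_part h2').trans (part_eq_of_mem_part h2).symm
    obtain ⟨σ, hσ⟩ := (x.bar_eq_iff _ (x.blocks.part_mem.2 (Finset.mem_univ _))).1 h4
    exact h1 σ (hσ ▸ x.blocks.mem_part (Finset.mem_univ p))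
  · exact absurd h' (h.1 τ)
  · exact absurd h (h'.1 σ)
  · have h1 : p ∈ x.signedBlock σ := h
    rw [x.signedBlock_inj σ τ ⟨p, h⟩ ((part_eq_signedBlock h1).symm.trans (part_eq_signedBlock h'))]

theorem IsValue.part_eq (h : IsValue x p v) (h' : IsValue x q v) :
    x.blocks.part p = x.blocks.part q := by
  rcases v with r | σ
  · rw [← part_eq_of_mem_part h.2.1, part_eq_of_mem_part h'.2.1]
  · rw [part_eq_signedBlock (show p ∈ x.signedBlock σ from h),
      part_eq_signedBlock (show q ∈ x.signedBlock σ from h')]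

theorem exists_isValue (x : LabeledPartition n S) (p : SignedSet n) : ∃ v, IsValue x p v := by
  by_cases h : ∃ σ, p ∈ x.signedBlock σ
  · obtain ⟨σ, hσ⟩ := h
    exact ⟨.inr σ, hσ⟩
  · push Not at h
    obtain ⟨r, hr, hmin⟩ := Finset.exists_min_image (x.blocks.part p) Prod.fst
      ⟨p, x.blocks.mem_part (Finset.mem_univ _)⟩
    exact ⟨.inl r, h, hr, hmin⟩

theorem isValue_rep {r : Fin n} {e : Bool} (h : IsValue x p (.inl (r, e))) :
    IsValue x (r, false) (.inl (r, false)) := by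
  have h1 : IsValue x (r, e) (.inl (r, e)) := (isValue_iff_of_mem_part h.2.1).2 h
  cases e
  · exact h1
  · simpa using isValue_bar h1

end IsValue

/-- Each element has exactly one value, and equal values mean equal blocks; the values of the
unbarred elements form the code. -/
theorem toLabeledPartition_surjective :
    Function.Surjective (toLabeledPartition : PartitionCode n S → LabeledPartition n S) := by
  intro x
  choose f hf using exists_isValue x
  let a : PartitionCode n S :=
    { val := fun i => f (i, false)
      le_of_val := fun {i r e} h => by
        have := hf (i, false)
        rw [h] at this
        exact this.2.2 _ (x.blocks.mem_part (Finset.mem_univ _))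
      val_of_val := fun {i r e} h => by
        have := hf (i, false)
        rw [h] at this
        exact (hf _).unique (isValue_rep this) }
  have hval : ∀ p, IsValue x p (a.ext' (.inl p)) := fun p => isValue_twist p.2 (hf (p.1, false))
  have hfib : ∀ p, a.fiber (a.ext' (.inl p)) = x.blocks.part p := by
    intro p
    ext q
    rw [mem_fiber]
    constructor
    · intro h
      rw [← IsValue.part_eq (h ▸ hval q) (hval p)]
      exact x.blocks.mem_part (Finset.mem_univ _)
    · intro h
      exact (hval q).unique ((isValue_iff_of_mem_part h).2 (hval p))
  refine ⟨a, LabeledPartition.ext (Finpartition.ext (Finset.ext fun R => ?_)) (funext fun σ => ?_)⟩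
  · rw [mem_blocks_toLabeledPartition]
    constructor
    · rintro ⟨p, rfl⟩
      rw [hfib]
      exact x.blocks.part_mem.2 (Finset.mem_univ _)
    · intro hR
      obtain ⟨p, hp⟩ := x.blocks.nonempty_of_mem_parts hR
      exact ⟨p, by rw [hfib, x.blocks.part_eq_of_mem hR hp]⟩
  · ext p
    rw [signedBlock_toLabeledPartition, mem_fiber]
    constructor
    · intro h
      have := hval p
      rwa [h] at this
    · intro h
      exact (hval p).unique h

/-- Labeled partitions are the same as their codes. -/
noncomputable def orderIsoLabeledPartition : PartitionCode n S ≃o LabeledPartition n S :=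
  RelIso.ofSurjective (OrderEmbedding.ofMapLEIff toLabeledPartition
    fun _ _ => toLabeledPartition_le_iff) toLabeledPartition_surjective

/-! ### The families -/

theorem ext'_inl_eq_inr {a : PartitionCode n S} {p : SignedSet n} {σ : S} :
    a.ext' (.inl p) = .inr σ ↔ a.val p.1 = .inr σ := by
  rw [← Prod.mk.eta (p := p), ext'_inl, twist_eq_inr]

open Classical in
theorem card_fiber_inr (a : PartitionCode n S) (σ : S) :
    (a.fiber (.inr σ)).card = 2 * (Finset.univ.filter fun i => a.val i = .inr σ).card := by
  have : a.fiber (.inr σ) =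
      (Finset.univ.filter fun i => a.val i = .inr σ) ×ˢ (Finset.univ : Finset Bool) := by
    ext p
    rw [mem_fiber, ext'_inl_eq_inr]
    simp
  rw [this, Finset.card_product]
  simp [mul_comm]

/-- A signed block contains each of its indices both with and without a bar, so two elements amount
to a single index. -/
theorem card_fiber_inr_ne_two {a : PartitionCode n S} {σ : S} :
    (a.fiber (.inr σ)).card ≠ 2 ↔ ∀ i, a.val i = .inr σ → ∃ k, k ≠ i ∧ a.val k = .inr σ := by
  classical
  rw [card_fiber_inr]
  have : 2 * (Finset.univ.filter fun i => a.val i = .inr σ).card ≠ 2 ↔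
      (Finset.univ.filter fun i => a.val i = .inr σ).card ≠ 1 := by omega
  rw [this, Ne, Finset.card_eq_one]
  constructor
  · intro h i hi
    by_contra! H
    refine h ⟨i, ?_⟩
    ext k
    simp only [Finset.mem_filter_univ, Finset.mem_singleton]
    exact ⟨fun hk => by_contra fun hne => H k hne hk, fun hk => hk ▸ hi⟩
  · rintro h ⟨i, hi⟩
    have hmem : ∀ k, a.val k = .inr σ ↔ k = i := by
      intro k
      simpa using Finset.ext_iff.1 hi k
    obtain ⟨k, hk, hk2⟩ := h i ((hmem i).2 rfl)
    exact hk ((hmem k).1 hk2)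

theorem ofFamily_toLabeledPartition {σ₀ : S} {t : WeylFamily} {a : PartitionCode n S} :
    OfFamily σ₀ t a.toLabeledPartition ↔ a.InFamily σ₀ t := by
  cases t with
  | A =>
    simp only [OfFamily, InFamily, Restricted, false_imp_iff, implies_true, and_true,
      true_imp_iff]
    constructor
    · intro h i
      have hi : ((i, false) : SignedSet n) ∈ a.fiber (a.ext' (.inl (i, false))) := mem_fiber.2 rfl
      have h1 : ∀ p ∈ a.fiber (a.ext' (.inl (i, false))), p.2 = false := by
        refine (h _ (mem_blocks_toLabeledPartition.2 ⟨(i, false), rfl⟩)).resolve_right fun h2 => ?_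
        simpa using h2 _ hi
      rcases hv : a.val i with ⟨r, e⟩ | σ
      · have h2 := h1 (r, e) (mem_fiber.2 (by simp [hv, a.val_of_val hv]))
        exact ⟨r, by rw [← h2]⟩
      · have h2 := h1 (i, true) (mem_fiber.2 (by simp [hv]))
        simp at h2
    · intro h R hR
      obtain ⟨p, rfl⟩ := mem_blocks_toLabeledPartition.1 hR
      have h1 : ∀ q ∈ a.fiber (a.ext' (.inl p)), q.2 = p.2 := by
        rintro ⟨i, e⟩ hq
        obtain ⟨j, f⟩ := p
        rw [mem_fiber] at hq
        obtain ⟨r, hr⟩ := h i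
        obtain ⟨s, hs⟩ := h j
        simp [hr, hs] at hq
        exact hq.2
      cases hp : p.2
      · exact Or.inl fun q hq => (h1 q hq).trans hp
      · exact Or.inr fun q hq => (h1 q hq).trans hp
  | B =>
    simp [OfFamily, InFamily, Restricted, -ne_eq, card_fiber_inr_ne_two]
    exact ⟨fun h σ i hσ => h σ hσ i, fun h σ hσ i => h σ i hσ⟩
  | C => simp [OfFamily, InFamily, Restricted]
  | D => simp [OfFamily, InFamily, Restricted, -ne_eq, card_fiber_inr_ne_two]

/-- The labeled partitions of a given type are the same as their codes. -/
noncomputable def orderIsoFamilyPoset (n : ℕ) (σ₀ : S) (t : WeylFamily) :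
    {a : PartitionCode n S // a.InFamily σ₀ t} ≃o FamilyPoset n σ₀ t where
  toEquiv := orderIsoLabeledPartition.toEquiv.subtypeEquiv fun _ =>
    ofFamily_toLabeledPartition.symm
  map_rel_iff' := toLabeledPartition_le_iff

end PartitionCode

/-! ### The labeling λ in terms of codes -/

namespace PartitionCode

variable {n : ℕ} {S : Type u} {a c : PartitionCode n S} {i j k : Fin n} {v : SignedSet n ⊕ S}

theorem signs_toLabeledPartition (a : PartitionCode n S) : a.toLabeledPartition.signs = a.signs := by
  ext σ
  constructor
  · rintro ⟨p, hp⟩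
    exact ⟨p.1, ext'_inl_eq_inr.1 (mem_fiber.1 hp)⟩
  · rintro ⟨i, hi⟩
    exact ⟨(i, false), mem_fiber.2 (ext'_inl_eq_inr.2 hi)⟩

theorem IsRep.mem_fiber {e : Bool} (hi : a.IsRep i) : (i, e) ∈ a.fiber (.inl (i, e)) := by
  rw [PartitionCode.mem_fiber, ext'_inl, hi]
  simp

theorem representative_fiber (hi : a.IsRep i) (e : Bool) :
    representative (a.fiber (.inl (i, e))) = (i : ℕ) + 1 := by
  refine le_antisymm (Nat.sInf_le ⟨(i, e), hi.mem_fiber, rfl⟩) (le_csInf ⟨_, (i, e),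
    hi.mem_fiber, rfl⟩ ?_)
  rintro m ⟨⟨k, f⟩, hk, rfl⟩
  rw [mem_fiber, ext'_inl] at hk
  have h1 := congrArg (twist f) hk
  rw [twist_self, twist_inl] at h1
  have h2 : i ≤ k := a.le_of_val h1
  simpa using h2

theorem isNormalized_iff {R : Finset (SignedSet n)} :
    (R ∈ a.toLabeledPartition.blocks.parts ∧ bar R ≠ R ∧ IsNormalized R) ↔
      ∃ i, a.IsRep i ∧ R = a.fiber (.inl (i, false)) := by
  constructor
  · rintro ⟨hR, hbar, p, hp, hp2, hp3⟩
    obtain ⟨q, rfl⟩ := mem_blocks_toLabeledPartition.1 hR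
    rcases hv : a.ext' (.inl q) with ⟨r, e⟩ | σ
    · have hr : a.IsRep r := by
        have h1 := congrArg (twist q.2) hv
        rw [← Prod.mk.eta (p := q), ext'_inl, twist_self, twist_inl] at h1
        exact isRep_of_val h1
      refine ⟨r, hr, ?_⟩
      rw [hv] at hp hp3
      rw [representative_fiber hr] at hp3
      obtain ⟨i, f⟩ := p
      obtain rfl : i = r := Fin.ext (by simpa using hp3)
      obtain rfl : f = false := hp2
      rw [mem_fiber, ext'_inl, hr] at hp
      obtain rfl : false = e := by simpa using hp
      rfl
    · rw [hv, bar_fiber, twist_inr] at hbar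
      exact absurd rfl hbar
  · rintro ⟨i, hi, rfl⟩
    refine ⟨mem_blocks_toLabeledPartition.2 ⟨(i, false), by rw [ext'_inl, hi]; rfl⟩, ?_,
      (i, false), hi.mem_fiber, rfl, (representative_fiber hi false).symm⟩
    intro h
    have h1 : ((i, false) : SignedSet n) ∈ a.fiber (.inl (i, false)) := hi.mem_fiber
    rw [← h, bar_fiber, mem_fiber, ext'_inl, hi] at h1
    simp at h1

theorem isNormalizedPair_iff {R R' : Finset (SignedSet n)} :
    IsNormalizedPair a.toLabeledPartition R R' ↔ ∃ i j, i ≠ j ∧ a.IsRep i ∧ a.IsRep j ∧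
      R = a.fiber (.inl (i, false)) ∧ R' = a.fiber (.inl (j, false)) := by
  rw [IsNormalizedPair, isNormalized_iff, isNormalized_iff]
  constructor
  · rintro ⟨hne, ⟨i, hi, rfl⟩, ⟨j, hj, rfl⟩⟩
    exact ⟨i, j, fun h => hne (by rw [h]), hi, hj, rfl, rfl⟩
  · rintro ⟨i, j, hij, hi, hj, rfl, rfl⟩
    refine ⟨fun h => hij ?_, ⟨i, hi, rfl⟩, ⟨j, hj, rfl⟩⟩
    have h1 : ((i, false) : SignedSet n) ∈ a.fiber (.inl (i, false)) := hi.mem_fiber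
    rw [h, mem_fiber, ext'_inl, hi] at h1
    simpa using h1

theorem ext'_eq_of_union_mem {v w : SignedSet n ⊕ S} {p q : SignedSet n}
    (h : a.fiber v ∪ a.fiber w ∈ c.toLabeledPartition.blocks.parts) (hp : p ∈ a.fiber v)
    (hq : q ∈ a.fiber w) : c.ext' (.inl p) = c.ext' (.inl q) := by
  obtain ⟨s, hs⟩ := mem_blocks_toLabeledPartition.1 h
  have h1 : p ∈ a.fiber v ∪ a.fiber w := Finset.mem_union_left _ hp
  have h2 : q ∈ a.fiber v ∪ a.fiber w := Finset.mem_union_right _ hq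
  rw [hs, mem_fiber] at h1 h2
  rw [h1, h2]

namespace Step

theorem val_of_isRep (h : Step a j v c) (hk : a.IsRep k) (hkj : k ≠ j) :
    c.val k = .inl (k, false) := h.isRep_iff.2 ⟨hk, hkj⟩

theorem subst_twist (j : Fin n) (v w : SignedSet n ⊕ S) (e : Bool) :
    subst j v (twist e w) = twist e (subst j v w) := by
  rcases w with ⟨k, d⟩ | σ
  · simp only [twist_inl, subst]
    split_ifs <;> simp [twist_twist]
  · rfl

theorem ext'_eq (h : Step a j v c) (p : SignedSet n) :
    c.ext' (.inl p) = subst j v (a.ext' (.inl p)) := by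
  obtain ⟨k, e⟩ := p
  rw [ext'_inl, ext'_inl, subst_twist, h.val_eq]

theorem union_mem {e : Bool} (h : Step a j (.inl (i, e)) c) :
    a.fiber (.inl (i, false)) ∪ a.fiber (.inl (j, e)) ∈ c.toLabeledPartition.blocks.parts := by
  obtain ⟨hij, hi⟩ := h.adm rfl
  refine mem_blocks_toLabeledPartition.2 ⟨(i, false), ?_⟩
  ext p
  have hci : c.ext' (.inl (i, false)) = .inl (i, false) := by
    rw [ext'_inl, h.val_of_isRep hi hij.ne, twist_false]
  rw [Finset.mem_union, mem_fiber, mem_fiber, mem_fiber, hci, h.ext'_eq]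
  rcases a.ext' (.inl p) with ⟨k, d⟩ | σ
  · rw [subst]
    split_ifs with hk
    · subst hk
      cases d <;> cases e <;> simp [hij.ne']
    · simp [hk]
  · simp [subst]

theorem not_ssubset (h : Step a j v c) (hv : ∀ σ, v ≠ .inr σ) (σ : S) :
    ¬ a.toLabeledPartition.signedBlock σ ⊂ c.toLabeledPartition.signedBlock σ := by
  rcases v with p | τ
  · intro hs
    refine hs.2 fun q hq => ?_
    rw [signedBlock_toLabeledPartition, mem_fiber, ext'_inl_eq_inr] at hq ⊢
    exact h.val_inr_iff_of_inl.1 hq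
  · exact absurd rfl (hv τ)

theorem ssubset_iff {σ τ : S} (h : Step a j (.inr τ) c) :
    a.toLabeledPartition.signedBlock σ ⊂ c.toLabeledPartition.signedBlock σ ↔ σ = τ := by
  constructor
  · intro hs
    by_contra hne
    refine hs.2 fun q hq => ?_
    rw [signedBlock_toLabeledPartition, mem_fiber, ext'_inl_eq_inr] at hq ⊢
    exact (h.val_inr_iff.1 hq).resolve_right fun h' => hne h'.1
  · rintro rfl
    refine ⟨(toLabeledPartition_le_iff.2 h.le).1 σ, fun hs => ?_⟩
    have h1 : ((j, false) : SignedSet n) ∈ a.toLabeledPartition.signedBlock σ := hs (by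
      rw [signedBlock_toLabeledPartition, mem_fiber, ext'_inl_eq_inr]
      exact h.val_self)
    rw [signedBlock_toLabeledPartition, mem_fiber, ext'_inl_eq_inr, h.isRep] at h1
    simp at h1

/-- The label is defined from a chosen pair of blocks; any possible choice yields the same maximum,
and none exists for a noncoherent step. -/
theorem coherent_pair {p : SignedSet n} {R R' : Finset (SignedSet n)} (h : Step a j (.inl p) c)
    (hR : IsNormalizedPair a.toLabeledPartition R R')
    (hc : R ∪ R' ∈ c.toLabeledPartition.blocks.parts) :
    p.2 = false ∧ max (representative R) (representative R') = (j : ℕ) + 1 := by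
  obtain ⟨k, l, hkl, hk, hl, rfl, rfl⟩ := isNormalizedPair_iff.1 hR
  have h1 := ext'_eq_of_union_mem hc hk.mem_fiber hl.mem_fiber
  rw [representative_fiber hk, representative_fiber hl]
  simp only [ext'_inl, twist_false] at h1
  by_cases hkj : k = j
  · subst hkj
    rw [h.val_self, h.val_of_isRep hl hkl.symm] at h1
    obtain rfl : p = (l, false) := by simpa using h1
    exact ⟨rfl, max_eq_left (by simpa using (h.adm rfl).1.le)⟩
  · rw [h.val_of_isRep hk hkj] at h1
    by_cases hlj : l = j
    · subst hlj
      rw [h.val_self] at h1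
      obtain rfl : (k, false) = p := by simpa using h1
      exact ⟨rfl, max_eq_right (by simpa using (h.adm rfl).1.le)⟩
    · rw [h.val_of_isRep hl hlj] at h1
      exact absurd (by simpa using h1) hkl

theorem noncoherent_pair {R R' : Finset (SignedSet n)} (h : Step a j (.inl (i, true)) c)
    (hR : IsNormalizedPair a.toLabeledPartition R R')
    (hc : R ∪ bar R' ∈ c.toLabeledPartition.blocks.parts) :
    min (representative R) (representative R') = (i : ℕ) + 1 := by
  obtain ⟨k, l, hkl, hk, hl, rfl, rfl⟩ := isNormalizedPair_iff.1 hR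
  rw [bar_fiber] at hc
  have h1 := ext'_eq_of_union_mem hc hk.mem_fiber hl.mem_fiber
  rw [representative_fiber hk, representative_fiber hl]
  have hij : i ≤ j := (h.adm rfl).1.le
  simp only [ext'_inl, twist_false] at h1
  by_cases hkj : k = j
  · subst hkj
    rw [h.val_self, h.val_of_isRep hl hkl.symm] at h1
    obtain rfl : i = l := by simpa using h1
    exact min_eq_right (by simpa using hij)
  · rw [h.val_of_isRep hk hkj] at h1
    by_cases hlj : l = j
    · subst hlj
      rw [h.val_self] at h1
      obtain rfl : k = i := by simpa using h1
      exact min_eq_left (by simpa using hij)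
    · rw [h.val_of_isRep hl hlj] at h1
      simp at h1

theorem partitionLabel_eq [LinearOrder S] (h : Step a j v c) :
    partitionLabel a.toLabeledPartition c.toLabeledPartition = stepLabel a j v := by
  rcases v with ⟨i, e⟩ | σ
  · have h0 : ¬ ∃ σ, a.toLabeledPartition.signedBlock σ ⊂ c.toLabeledPartition.signedBlock σ := by
      rintro ⟨σ, hσ⟩
      exact h.not_ssubset (by simp) σ hσ
    obtain ⟨hij, hi⟩ := h.adm rfl
    have hpair := isNormalizedPair_iff.2 ⟨i, j, hij.ne, hi, h.isRep, rfl, rfl⟩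
    rw [partitionLabel, dif_neg h0]
    cases e
    · have h1 : ∃ q : Finset (SignedSet n) × Finset (SignedSet n),
          IsNormalizedPair a.toLabeledPartition q.1 q.2 ∧
            q.1 ∪ q.2 ∈ c.toLabeledPartition.blocks.parts := ⟨(_, _), hpair, h.union_mem⟩
      rw [dif_pos h1, (h.coherent_pair h1.choose_spec.1 h1.choose_spec.2).2]
      rfl
    · have h1 : ¬ ∃ q : Finset (SignedSet n) × Finset (SignedSet n),
          IsNormalizedPair a.toLabeledPartition q.1 q.2 ∧
            q.1 ∪ q.2 ∈ c.toLabeledPartition.blocks.parts := by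
        rintro ⟨q, hq1, hq2⟩
        simpa using (h.coherent_pair hq1 hq2).1
      have h2 : ∃ q : Finset (SignedSet n) × Finset (SignedSet n),
          IsNormalizedPair a.toLabeledPartition q.1 q.2 ∧
            q.1 ∪ bar q.2 ∈ c.toLabeledPartition.blocks.parts :=
        ⟨(_, _), hpair, by
          change _ ∪ bar (a.fiber _) ∈ _
          rw [bar_fiber]
          exact h.union_mem⟩
      rw [dif_neg h1, dif_pos h2, h.noncoherent_pair h2.choose_spec.1 h2.choose_spec.2]
      rfl
  · have h1 : ∃ τ, a.toLabeledPartition.signedBlock τ ⊂ c.toLabeledPartition.signedBlock τ :=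
      ⟨σ, h.ssubset_iff.2 rfl⟩
    have h2 : h1.choose = σ := h.ssubset_iff.1 h1.choose_spec
    rw [partitionLabel, dif_pos h1, h2, signs_toLabeledPartition, stepLabel, signRank]
    split_ifs <;> rfl

end Step

/-! ### The edge labeling is an EL-labeling -/

section Labeling

variable [LinearOrder S] {σ₀ : S} {t : WeylFamily}

theorem isStepLabeling_familyLabel : IsStepLabeling (σ₀ := σ₀) (t := t) (n := n)
    fun x y => familyLabel (orderIsoFamilyPoset n σ₀ t x) (orderIsoFamilyPoset n σ₀ t y) :=
  fun _ _ _ _ h => h.partitionLabel_eq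

variable [Finite S]

theorem goodInterval_familyLabel {x y : FamilyPoset n σ₀ t} (h : x < y) :
    GoodInterval familyLabel x y :=
  GoodInterval.congr_orderIso (orderIsoFamilyPoset n σ₀ t).symm (fun x y => by simp)
    (isStepLabeling_familyLabel.goodInterval ((orderIsoFamilyPoset n σ₀ t).symm.lt_iff_lt.2 h))

theorem goodInterval_familyLabelTop (hB : t = .B → n = 1 → ∀ σ, σ₀ ≤ σ)
    {x y : WithTop (FamilyPoset n σ₀ t)} (h : x < y) : GoodInterval familyLabelTop x y := by
  cases x with
  | top => exact absurd h not_top_lt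
  | coe x =>
  cases y with
  | coe y => exact (goodInterval_familyLabel (WithTop.coe_lt_coe.1 h)).withTop fun _ _ => rfl
  | top =>
    refine GoodInterval.congr_orderIso (orderIsoFamilyPoset n σ₀ t).withTopCongr.symm
      (lab' := fun x y => familyLabelTop ((orderIsoFamilyPoset n σ₀ t).withTopCongr x)
        ((orderIsoFamilyPoset n σ₀ t).withTopCongr y)) (fun x y => by simp) ?_
    exact isStepLabeling_familyLabel.goodInterval_top
      (a := (orderIsoFamilyPoset n σ₀ t).symm x) hB (fun _ _ => rfl) (fun _ => rfl)

end Labeling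

theorem finite_familyPoset [Finite S] (n : ℕ) (σ₀ : S) (t : WeylFamily) :
    Finite (FamilyPoset n σ₀ t) :=
  have : Finite (PartitionCode n S) := finite
  Finite.of_equiv _ (orderIsoFamilyPoset n σ₀ t).toEquiv

/-! ### Least and greatest elements -/

theorem exists_isBot (n : ℕ) (σ₀ : S) (t : WeylFamily) : ∃ b : FamilyPoset n σ₀ t, IsBot b := by
  let a : {a : PartitionCode n S // a.InFamily σ₀ t} :=
    ⟨⟨fun i => .inl (i, false), fun h => by simp at h; exact h.1.ge, fun h => by simp at h ⊢⟩,
      fun _ i => ⟨i, rfl⟩, fun σ i _ h => by simp at h⟩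
  refine ⟨orderIsoFamilyPoset n σ₀ t a, fun x => ?_⟩
  rw [← (orderIsoFamilyPoset n σ₀ t).le_symm_apply]
  exact fun i => by simp [a]

theorem exists_isTop_A (n : ℕ) (σ₀ : S) : ∃ b : FamilyPoset n σ₀ .A, IsTop b := by
  -- The greatest element has the single representative 0, which exists only for n > 0.
  rcases n with _ | n
  · obtain ⟨b, -⟩ := exists_isBot 0 σ₀ .A
    refine ⟨b, fun x => ?_⟩
    rw [← (orderIsoFamilyPoset 0 σ₀ .A).symm.le_iff_le]
    exact fun i => i.elim0
  · let a : {a : PartitionCode (n + 1) S // a.InFamily σ₀ .A} :=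
      ⟨⟨fun _ => .inl (0, false), fun h => by simp at h; rw [← h.1]; exact Fin.zero_le _,
        fun h => by simp at h ⊢; exact h.1⟩,
        fun _ _ => ⟨0, rfl⟩, fun σ i _ h => by simp at h⟩
    refine ⟨orderIsoFamilyPoset (n + 1) σ₀ .A a, fun x => ?_⟩
    rw [← (orderIsoFamilyPoset (n + 1) σ₀ .A).symm_apply_le]
    intro i
    obtain ⟨r, hr⟩ := ((orderIsoFamilyPoset (n + 1) σ₀ .A).symm x).2.1 rfl i
    simp [a, hr]

end PartitionCode

/-- EL-shellability allows a free choice of the order on the signs; with σ₀ least, type B with n = 1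
is covered too. -/
theorem exists_linearOrder_forall_le {S : Type u} [Finite S] (s : S) :
    ∃ _ : LinearOrder S, ∀ x, s ≤ x := by
  obtain ⟨m, ⟨e⟩⟩ := Finite.exists_equiv_fin S
  have : NeZero m := ⟨by rintro rfl; exact (e s).elim0⟩
  let f : S ≃ Fin m := e.trans (Equiv.swap (e s) 0)
  refine ⟨LinearOrder.lift' f f.injective, fun x => ?_⟩
  change f s ≤ f x
  simp [f]

/-- A bounded finite poset with good intervals is EL-shellable. -/
theorem isELShellable_of_goodInterval {P : Type u} [PartialOrder P] [Finite P]
    {Λ : Type} [LinearOrder Λ] {lab : P → P → Λ} (hbot : ∃ b : P, IsBot b)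
    (htop : ∃ t : P, IsTop t) (h : ∀ x y, x < y → GoodInterval lab x y) : IsELShellable P :=
  ⟨hbot, htop, ULift Λ, inferInstance, fun x y => ⟨lab x y⟩, isELLabeling_of_goodInterval
    fun x y hxy => (h x y hxy).comp_orderEmbedding ULift.orderIso.symm.toOrderEmbedding⟩

theorem mainTheorem3 {S : Type u} [Finite S] (σ₀ : S) (n : ℕ) :
    -- with the top element added, the posets of all four types are EL-shellable
    (∀ t : WeylFamily, IsELShellable (WithTop (FamilyPoset n σ₀ t))) ∧
    -- without it, type `A` is EL-shellable, and so is every type that still has a greatest element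
    IsELShellable (FamilyPoset n σ₀ .A) ∧
    (∀ t : WeylFamily, (∃ m : FamilyPoset n σ₀ t, IsTop m) → IsELShellable (FamilyPoset n σ₀ t)) ∧
    -- the labeling `λ` of all labeled partitions restricts to EL-labelings of these posets
    (∀ (_ : LinearOrder S) (t : WeylFamily), (t = .B → n = 1 → ∀ σ, σ₀ ≤ σ) →
      IsELLabeling (familyLabelTop : WithTop (FamilyPoset n σ₀ t) → _ → ℕ ×ₗ ℕ) ∧
      IsELLabeling (familyLabel : FamilyPoset n σ₀ t → _ → ℕ ×ₗ ℕ)) := by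
  have hfin : ∀ t : WeylFamily, Finite (FamilyPoset n σ₀ t) :=
    PartitionCode.finite_familyPoset n σ₀
  have hfin' : ∀ t : WeylFamily, Finite (WithTop (FamilyPoset n σ₀ t)) := fun t =>
    inferInstanceAs (Finite (Option (FamilyPoset n σ₀ t)))
  have hbot := PartitionCode.exists_isBot n σ₀
  have hshell : ∀ t : WeylFamily, (∃ m : FamilyPoset n σ₀ t, IsTop m) →
      IsELShellable (FamilyPoset n σ₀ t) := by
    intro t ht
    obtain ⟨_, -⟩ := exists_linearOrder_forall_le σ₀
    exact isELShellable_of_goodInterval (hbot t) ht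
      fun _ _ => PartitionCode.goodInterval_familyLabel
  refine ⟨fun t => ?_, hshell .A (PartitionCode.exists_isTop_A n σ₀), hshell, fun _ t hB => ?_⟩
  · obtain ⟨_, hmin⟩ := exists_linearOrder_forall_le σ₀
    obtain ⟨b, hb⟩ := hbot t
    refine isELShellable_of_goodInterval ⟨b, fun x => ?_⟩ ⟨⊤, fun _ => le_top⟩
      fun _ _ => PartitionCode.goodInterval_familyLabelTop fun _ _ => hmin
    cases x with
    | top => exact le_top
    | coe x => exact WithTop.coe_le_coe.2 (hb x)
  · exact ⟨isELLabeling_of_goodInterval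
        fun _ _ => PartitionCode.goodInterval_familyLabelTop hB,
      isELLabeling_of_goodInterval fun _ _ => PartitionCode.goodInterval_familyLabel⟩
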